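/- **Network.** Let $n\ge 1$ and consider a network with nodes $1,\dots,n$ whose lines have impedances $Z_{ij}=Z_{ji}=|Z_{ij}|e^{\sqrt{-1}\,\phi}\neq 0$ and whose shunt elements, present at some of the nodes, have impedances $\hat Z_{ii}=|\hat Z_{ii}|e^{\sqrt{-1}\,\phi}\neq 0$, all with the same angle $\phi\in[0,\frac{\pi}{2}]$. Put $B_{ij}=|Z_{ij}|^{-1}$ for each line $\{i,j\}$, $\hat B_{ii}=|\hat Z_{ii}|^{-1}$ (and $\hat B_{ii}=0$ if node $i$ has no shunt element), $B_{ii}=\hat B_{ii}+\sum_{j\in\mathcal N_i}B_{ij}$. For phases $\theta$ and voltage magnitudes $V\in\mathbb R^n_{>0}$ let $\theta_{ij}=\theta_i-\theta_j$ and $$P_i=\sum_{j\in\mathcal N_i}B_{ij}V_iV_j\sin\theta_{ij},\qquad Q_i=B_{ii}V_i^2-\sum_{j\in\mathcal N_i}B_{ij}V_iV_j\cos\theta_{ij}.$$ Let $P_i^\ell+\sqrt{-1}\,Q_i^\ell$ be the complex power that inverter $i$ exchanges with the lossy network (with voltage phasors $V_ie^{\sqrt{-1}\,\theta_i}$); equivalently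 $P_i^\ell=P_i\sin\phi+Q_i\cos\phi$, $Q_i^\ell=-P_i\cos\phi+Q_i\sin\phi$. Let $D$ be an incidence matrix of the network, so that $D^T\theta$ is the vector of phase differences over the lines. **Dynamics.** Let $T_P,K_P,K_Q$ be positive definite diagonal matrices, with diagonal entries $(k_P)_i$, $(k_Q)_i$ of $K_P$, $K_Q$; let $P^*\in\mathbb R^n$, let $\omega^*$ be a multiple of the all-ones vector $\mathbb 1$, and let $L_P,L_Q$ be Laplacians of connected undirected communication graphs (with positive edge weights). Consider $$\begin{aligned}\dot\theta&=\omega,\\ T_P\dot\omega&=-(\omega-\omega^*)-K_P(P^\ell\sin\phi-Q^\ell\cos\phi-P^*)+\xi,\\ \dot V&=-[V]K_QL_QK_Q(P^\ell\cos\phi+Q^\ell\sin\phi),\\ \dot\xi&=-L_P\xi+K_P^{-1}(\omega^*-\omega),\end{aligned}$$ where $[V]=\mathrm{diag}(V)$, with state space $V\in\mathbb R^n_{>0}$. Put $\bar u_P=-\mathbb 1\,\frac{\mathbb 1^TP^*}{\mathbb 1^TK_P^{-1}\mathbb 1}$. **Hypotheses.** Let $\theta^0\in\mathbb R^n$ and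 $\bar V\in\mathbb R^n_{>0}$, and let $\bar P,\bar Q$ be the values of $P,Q$ at $(\theta^0,\bar V)$. Suppose that 1. (feasibility) $\bar P=\Big(I-K_P^{-1}\frac{\mathbb 1\mathbb 1^T}{\mathbb 1^TK_P^{-1}\mathbb 1}\Big)P^*$ and $[\bar V]K_QL_QK_Q\bar Q=0$; 2. the Hessian with respect to $(\varphi,\omega,V)$ of $S=\frac12\omega^TK_P^{-1}T_P\,\omega+\frac12\mathbb 1^TQ-\bar Q^T\ln V$ ($\bar Q$ being held fixed), expressed in the relative phases $\varphi_i=\theta_i-\theta_r$, $i\ne r$, for a reference node $r$, is positive definite at the point given by $(\theta^0,\omega^*,\bar V)$. **Conclusion.** There is a neighbourhood of $(\theta^0,\omega^*,\bar V,\bar u_P)$ such that from each of its points a solution exists on $[0,\infty)$, and for every such solution $(\theta,\omega,V,\xi)$ the vector $(D^T\theta,\omega,V,\xi)$ converges as $t\to\infty$ to a point of the set $$\{(D^T\theta,\omega,V,\xi)\mid V\in\mathbb R^n_{>0},\ \omega=\omega^*,\ \xi=\bar u_P,\ P=\bar P,\ L_QK_QQ=0\}.$$ Along every solution on $[0,\infty)$,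 $\mathbb 1^TK_Q^{-1}\ln V(t)=\mathbb 1^TK_Q^{-1}\ln V(0)$ for all $t\ge0$. Finally, along the solutions that start in that neighbourhood, $P^\ell$ and $Q^\ell$ converge to constant vectors $\bar P^\ell,\bar Q^\ell$, and these satisfy, for all $i,j$, $$(k_P)_i\bar P^\ell_i=(k_P)_j\bar P^\ell_j,\qquad (k_Q)_i\bar Q^\ell_i=(k_Q)_j\bar Q^\ell_j,$$ provided that $\frac{(k_P)_i}{(k_P)_j}=\frac{(k_Q)_i}{(k_Q)_j}$ and $(k_P)_iP^*_i=(k_P)_jP^*_j$ for all $i,j$. -/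

import Mathlib

open Filter Topology

noncomputable section

namespace Microgrid

/-- A homogeneous lossy electrical network with node set `ι`: every line and every shunt element
has an impedance with one and the same phase angle `φ ∈ [0, π/2]`. -/
structure LossyNetwork (ι : Type*) where
  /-- the interconnection graph: adjacent nodes are joined by a line -/
  graph : SimpleGraph ι
  /-- the common phase angle of all impedances -/
  φ : ℝ
  φ_nonneg : 0 ≤ φ
  φ_le : φ ≤ Real.pi / 2
  /-- line impedances (only the values at adjacent pairs are used) -/
  Z : ι → ι → ℂ
  Z_symm : ∀ i j, Z i j = Z j i
  Z_ne_zero : ∀ i j, graph.Adj i j → Z i j ≠ 0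
  Z_homogeneous : ∀ i j, graph.Adj i j → Z i j = (‖Z i j‖ : ℂ) * Complex.exp (φ * Complex.I)
  /-- the nodes that carry a shunt element -/
  shunt : Set ι
  /-- shunt impedances (only the values at nodes of `shunt` are used) -/
  Zhat : ι → ℂ
  Zhat_ne_zero : ∀ i ∈ shunt, Zhat i ≠ 0
  Zhat_homogeneous : ∀ i ∈ shunt, Zhat i = (‖Zhat i‖ : ℂ) * Complex.exp (φ * Complex.I)

/-- An undirected connected communication graph with positive edge weights. -/
structure CommGraph (ι : Type*) where
  graph : SimpleGraph ι
  connected : graph.Connected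
  weight : ι → ι → ℝ
  weight_symm : ∀ i j, weight i j = weight j i
  weight_pos : ∀ i j, graph.Adj i j → 0 < weight i j
  weight_eq_zero : ∀ i j, ¬ graph.Adj i j → weight i j = 0

/-- The Laplacian of a communication graph, acting on vectors:
`(L x)_i = ∑_j a_ij (x_i - x_j)`. -/
def CommGraph.lap {ι : Type*} [Fintype ι] (C : CommGraph ι) (x : ι → ℝ) (i : ι) : ℝ :=
  ∑ j, C.weight i j * (x i - x j)

/-- A microgrid over a homogeneous lossy network, with the parameters of the inverters and of
the controllers. The diagonal matrices `T_P`, `K_P`, `K_Q` are given by their diagonals. -/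
structure LossyMicrogrid (ι : Type*) where
  net : LossyNetwork ι
  tP : ι → ℝ
  tP_pos : ∀ i, 0 < tP i
  kP : ι → ℝ
  kP_pos : ∀ i, 0 < kP i
  kQ : ι → ℝ
  kQ_pos : ∀ i, 0 < kQ i
  /-- the active power setpoints -/
  Pstar : ι → ℝ
  /-- the common frequency setpoint; the setpoint vector is constant with this value -/
  ωstar : ℝ
  /-- the communication graph with Laplacian `L_P` -/
  commP : CommGraph ι
  /-- the communication graph with Laplacian `L_Q` -/
  commQ : CommGraph ι

namespace LossyNetwork

variable {ι : Type*} (N : LossyNetwork ι)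

open Classical in
/-- `B_ij = |Z_ij|⁻¹` on lines, and `0` for pairs of nodes that are not joined by a line. -/
def B (i j : ι) : ℝ := if N.graph.Adj i j then ‖N.Z i j‖⁻¹ else 0

open Classical in
/-- `B̂_ii = |Ẑ_ii|⁻¹` at nodes with a shunt element, and `0` elsewhere. -/
def Bhat (i : ι) : ℝ := if i ∈ N.shunt then ‖N.Zhat i‖⁻¹ else 0

/-- The vector of phase differences `θ_i - θ_j` over the lines. Each line appears in both of its
orientations, with opposite values, so this is `Dᵀ θ` for every choice of the orientations that
define the incidence matrix `D`. -/
def phaseDiff (θ : ι → ℝ) (d : N.graph.Dart) : ℝ := θ d.fst - θ d.snd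

variable [Fintype ι]

/-- The active power `P_i = ∑_{j ∈ N_i} B_ij V_i V_j sin θ_ij`. -/
def P (θ V : ι → ℝ) (i : ι) : ℝ :=
  ∑ j, N.B i j * V i * V j * Real.sin (θ i - θ j)

/-- The reactive power `Q_i = B_ii V_i² - ∑_{j ∈ N_i} B_ij V_i V_j cos θ_ij`,
with `B_ii = B̂_ii + ∑_{j ∈ N_i} B_ij`. -/
def Q (θ V : ι → ℝ) (i : ι) : ℝ :=
  (N.Bhat i + ∑ j, N.B i j) * V i ^ 2 - ∑ j, N.B i j * V i * V j * Real.cos (θ i - θ j)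

/-- The voltage phasor at node `i`. -/
def phasor (θ V : ι → ℝ) (i : ι) : ℂ := (V i : ℂ) * Complex.exp ((θ i : ℂ) * Complex.I)

open Classical in
/-- The current that leaves node `i` through its lines and its shunt element (Ohm's law). -/
def current (θ V : ι → ℝ) (i : ι) : ℂ :=
  (∑ j, if N.graph.Adj i j then (phasor θ V i - phasor θ V j) / N.Z i j else 0)
    + if i ∈ N.shunt then phasor θ V i / N.Zhat i else 0

/-- The complex power that the inverter at node `i` exchanges with the lossy network. -/
def complexPower (θ V : ι → ℝ) (i : ι) : ℂ :=
  phasor θ V i * (starRingEnd ℂ) (N.current θ V i)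

/-- The active power `P^ℓ_i` of inverter `i` in the lossy network. -/
def Ploss (θ V : ι → ℝ) (i : ι) : ℝ := (N.complexPower θ V i).re

/-- The reactive power `Q^ℓ_i` of inverter `i` in the lossy network. -/
def Qloss (θ V : ι → ℝ) (i : ι) : ℝ := (N.complexPower θ V i).im

end LossyNetwork

/-- The Hessian of `f` at `p` is positive definite. -/
def HessianPosDef {E : Type*} [NormedAddCommGroup E] [NormedSpace ℝ E] (f : E → ℝ) (p : E) : Prop :=
  ∀ v : E, v ≠ 0 → 0 < fderiv ℝ (fderiv ℝ f) p v v

open Classical in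
/-- The phase vector with reference phase `θ_r = 0` and `θ_i = φ_i` for the other nodes. -/
def extendPhase {ι : Type*} (r : ι) (φ : {i : ι // i ≠ r} → ℝ) (i : ι) : ℝ :=
  if h : i ≠ r then φ ⟨i, h⟩ else 0

/-- The relative phases `φ_i = θ_i - θ_r`, for `i ≠ r`. -/
def relPhase {ι : Type*} (r : ι) (θ : ι → ℝ) (i : {i : ι // i ≠ r}) : ℝ := θ i - θ r

namespace LossyMicrogrid

variable {ι : Type*} [Fintype ι] (M : LossyMicrogrid ι)

/-- The energy function `U = ½ ωᵀ K_P⁻¹ T_P ω + ½ 1ᵀ Q`. -/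
def U (θ ω V : ι → ℝ) : ℝ :=
  1 / 2 * ∑ i, (M.kP i)⁻¹ * M.tP i * ω i ^ 2 + 1 / 2 * ∑ i, M.net.Q θ V i

/-- The shaped energy `S = U + H` with `H(V) = - Q̄ᵀ ln V`, as a function of `(φ, ω, V)`, where
`φ` are the phases relative to the reference node `r`. -/
def S (r : ι) (Qbar : ι → ℝ)
    (x : ({i : ι // i ≠ r} → ℝ) × (ι → ℝ) × (ι → ℝ)) : ℝ :=
  M.U (extendPhase r x.1) x.2.1 x.2.2 - ∑ i, Qbar i * Real.log (x.2.2 i)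

/-- The optimal constant input `ū_P = - 1 (1ᵀ P*) / (1ᵀ K_P⁻¹ 1)`. -/
def uPbar (_i : ι) : ℝ := -((∑ j, M.Pstar j) / ∑ j, (M.kP j)⁻¹)

/-- The voltage field of the exponentially-scaled averaging reactive power controller,
`f(V, Q) = - [V] K_Q L_Q K_Q Q`. -/
def fEARP (V Q : ι → ℝ) (i : ι) : ℝ :=
  -(V i * (M.kQ i * M.commQ.lap (fun j => M.kQ j * Q j) i))

/-- Feasibility of the constant vectors `θ⁰` and `V̄ > 0`:
`P(θ⁰, V̄) = (I - K_P⁻¹ 1 1ᵀ / (1ᵀ K_P⁻¹ 1)) P*` and `f(V̄, Q(θ⁰, V̄)) = 0`. -/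
structure Feasible (θ0 Vbar : ι → ℝ) : Prop where
  V_pos : ∀ i, 0 < Vbar i
  active : ∀ i, M.net.P θ0 Vbar i =
    M.Pstar i - (M.kP i)⁻¹ * ((∑ j, M.Pstar j) / ∑ j, (M.kP j)⁻¹)
  reactive : ∀ i, M.fEARP Vbar (M.net.Q θ0 Vbar) i = 0

/-- `(θ, ω, V, ξ)` is a solution on `[0, ∞)` of the closed loop of the microgrid, in which the
measured powers `P^ℓ`, `Q^ℓ` enter through `P^ℓ sin φ - Q^ℓ cos φ` and `P^ℓ cos φ + Q^ℓ sin φ`,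
and of the integral controller `ξ' = - L_P ξ + K_P⁻¹ (ω* - ω)`, `u_P = ξ`. The voltages live in
the positive orthant. -/
structure IsSolution (θ ω V ξ : ℝ → ι → ℝ) : Prop where
  V_pos : ∀ t, 0 ≤ t → ∀ i, 0 < V t i
  deriv_θ : ∀ t, 0 ≤ t → ∀ i,
    HasDerivWithinAt (fun s => θ s i) (ω t i) (Set.Ici 0) t
  deriv_ω : ∀ t, 0 ≤ t → ∀ i,
    HasDerivWithinAt (fun s => ω s i)
      ((M.tP i)⁻¹ * (-(ω t i - M.ωstar)
        - M.kP i * (M.net.Ploss (θ t) (V t) i * Real.sin M.net.φ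
            - M.net.Qloss (θ t) (V t) i * Real.cos M.net.φ - M.Pstar i)
        + ξ t i)) (Set.Ici 0) t
  deriv_V : ∀ t, 0 ≤ t → ∀ i,
    HasDerivWithinAt (fun s => V s i)
      (M.fEARP (V t) (fun j => M.net.Ploss (θ t) (V t) j * Real.cos M.net.φ
        + M.net.Qloss (θ t) (V t) j * Real.sin M.net.φ) i) (Set.Ici 0) t
  deriv_ξ : ∀ t, 0 ≤ t → ∀ i,
    HasDerivWithinAt (fun s => ξ s i)
      (-M.commP.lap (ξ t) i + (M.kP i)⁻¹ * (M.ωstar - ω t i)) (Set.Ici 0) t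

/-- The set of the points `(Dᵀ θ, ω, V, ξ)`, with positive voltages, for which `ω = ω*`,
`ξ = ū_P`, `P = P̄` and `L_Q K_Q Q = 0`. -/
def limitSet (Pbar : ι → ℝ) :
    Set ((M.net.graph.Dart → ℝ) × (ι → ℝ) × (ι → ℝ) × (ι → ℝ)) :=
  {x | ∃ θ ω V ξ : ι → ℝ, x = (M.net.phaseDiff θ, ω, V, ξ) ∧ (∀ i, 0 < V i) ∧
    ω = (fun _ => M.ωstar) ∧ ξ = M.uPbar ∧ M.net.P θ V = Pbar ∧
    ∀ i, M.commQ.lap (fun j => M.kQ j * M.net.Q θ V j) i = 0}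

end LossyMicrogrid

end Microgrid

end

noncomputable section
namespace Microgrid

/-! ### Lyapunov stability, Barbalat's lemma and global solutions -/

open Metric Set

/-! Since all impedances share the angle φ, the lossy complex power is `e^{iφ}(Q - iP)`
(`complexPower_eq`). The combinations fed back by the controllers undo this rotation, so the closed
loop is exactly that of a lossless network with powers `P`, `Q`.

Work in the phases relative to node `r` and in `l = ln V`. The voltage equation becomes `l' = -K_Q
L_Q K_Q Q`, and the function `½ 1ᵀQ - Q̄ᵀ l - P̄ᵀ φ` (`potential`) has gradient `(P - P̄, Q - Q̄)`,
which vanishes at the given point. The linear tilt in φ does not affect the Hessian. Passing from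
`V` to `l` changes the Hessian only by a congruence, because the voltage gradient vanishes there
(`hessianPosDef_potential`). So the potential has a strict minimum and a strictly monotone gradient
near the point. Adding the quadratic energies of `ω - ω*` and `ξ - ū_P` gives a Lyapunov function
whose derivative is minus a sum of three nonnegative forms (`hasDerivWithinAt_lyap`). Trajectories
starting low enough are therefore trapped in a ball, which also yields global existence.

For convergence, Barbalat's lemma, applied first to the Lyapunov function and then to `ω`, takes the
place of the invariance principle: the dissipation and `ω'` tend to zero, and their common zeros are
equilibria (`isEquilibrium_of_dissipation_eq_zero`). Equilibria are not isolated, but `1ᵀ K_Q⁻¹ l`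
is conserved. Two nearby equilibria with the same value of it coincide
(`IsEquilibrium.eq_of_charge_eq`): their `K_Q Q` differ by a multiple of `1`, so the gradient
difference is orthogonal to the displacement, contrary to strict monotonicity. A trajectory in a
compact ball thus has a single cluster point, hence a limit. -/

/-- A continuous trajectory that starts below the minimum of `w` on a sphere, and along which `w`
cannot increase as long as it has stayed in the closed ball, never leaves the open ball. -/
theorem mem_ball_of_lyapunov {E : Type*} [PseudoMetricSpace E] {x : ℝ → E} {w : E → ℝ} {p : E}
    {ε m : ℝ} (hx : ContinuousOn x (Ici 0)) (h0 : x 0 ∈ ball p ε) (hm : ∀ y ∈ sphere p ε, m ≤ w y)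
    (hw0 : w (x 0) < m)
    (hw : ∀ T, 0 ≤ T → (∀ t ∈ Icc 0 T, x t ∈ closedBall p ε) → w (x T) ≤ w (x 0)) :
    ∀ t, 0 ≤ t → x t ∈ ball p ε := by
  intro t1 ht1
  by_contra hcon
  have hd : ContinuousOn (fun t => dist (x t) p) (Icc 0 t1) :=
    (continuous_id.dist continuous_const).comp_continuousOn (hx.mono fun _ h => h.1)
  -- The least element of this compact set is the first exit time `T`: the trajectory lies on the
  -- sphere at `T` and in the closed ball before it, so `w` is at once at least `m` and below `m`.
  set S : Set ℝ := Icc 0 t1 ∩ (fun t => dist (x t) p) ⁻¹' Ici ε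
  have hS : IsCompact S :=
    isCompact_Icc.of_isClosed_subset (hd.preimage_isClosed_of_isClosed isClosed_Icc isClosed_Ici)
      inter_subset_left
  have hne : S.Nonempty := ⟨t1, ⟨ht1, le_rfl⟩, by simpa [mem_ball] using hcon⟩
  obtain ⟨T, ⟨hT, hTε⟩, hmin⟩ := hS.exists_isLeast hne
  have hlt : ∀ t ∈ Icc 0 T, t ≠ T → dist (x t) p < ε := by
    intro t ht hne
    by_contra hge
    have : T ≤ t := hmin ⟨⟨ht.1, ht.2.trans hT.2⟩, not_lt.1 hge⟩
    exact hne (le_antisymm ht.2 this)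
  have hTeq : dist (x T) p = ε := by
    have hd' : ContinuousOn (fun t => dist (x t) p) (Icc 0 T) :=
      hd.mono (Icc_subset_Icc_right hT.2)
    obtain ⟨s, hs, hse⟩ := intermediate_value_Icc hT.1 hd' ⟨(mem_ball.1 h0).le, hTε⟩
    by_cases hsT : s = T
    · simpa [hsT] using hse
    · exact absurd hse (hlt s hs hsT).ne
  have hle : ∀ t ∈ Icc 0 T, x t ∈ closedBall p ε := by
    intro t ht
    by_cases h : t = T
    · rw [h]; exact hTeq.le
    · exact (hlt t ht h).le
  have := hw T hT.1 hle
  have := hm (x T) hTeq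
  linarith

/-- Barbalat's lemma: the derivative of a convergent function tends to zero, if it is uniformly
continuous. -/
theorem tendsto_deriv_zero_of_tendsto {g h : ℝ → ℝ} {l : ℝ}
    (hg : ∀ t, 0 ≤ t → HasDerivWithinAt g (h t) (Ici 0) t) (hl : Tendsto g atTop (𝓝 l))
    (hh : UniformContinuousOn h (Ici 0)) : Tendsto h atTop (𝓝 0) := by
  rw [Metric.tendsto_atTop]
  intro ε hε
  obtain ⟨δ, hδ, hUC⟩ := Metric.uniformContinuousOn_iff.1 hh (ε / 2) (by positivity)
  -- With `g` within η of its limit, the mean slope of `g` over an interval of length `δ / 2` is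
  -- below `2η / (δ / 2) = ε / 2`. Some value of `h` equals this slope, and uniform continuity
  -- carries the bound back to `t`.
  have hη : 0 < ε / 2 * (δ / 2) / 2 := by positivity
  obtain ⟨N, hN⟩ := Metric.tendsto_atTop.1 hl _ hη
  refine ⟨max N 0, fun t ht => ?_⟩
  have ht0 : 0 ≤ t := (le_max_right _ _).trans ht
  have htN : N ≤ t := (le_max_left _ _).trans ht
  have hcont : ContinuousOn g (Icc t (t + δ / 2)) := fun s hs =>
    ((hg s (ht0.trans hs.1)).continuousWithinAt).mono fun u hu => ht0.trans hu.1
  obtain ⟨c, hc, hce⟩ := exists_hasDerivAt_eq_slope g h (by linarith : t < t + δ / 2) hcont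
    fun s hs => (hg s (ht0.trans hs.1.le)).hasDerivAt (Ici_mem_nhds (ht0.trans_lt hs.1))
  have h1 := hN t htN
  have h2 := hN (t + δ / 2) (by linarith)
  have h3 := hUC t ht0 c (ht0.trans hc.1.le) (by
    rw [Real.dist_eq, abs_lt]; constructor <;> linarith [hc.1, hc.2])
  have h4 : |h c| < ε / 2 := by
    rw [hce, abs_div, div_lt_iff₀ (by rw [abs_pos]; linarith)]
    rw [Real.dist_eq, abs_lt] at h1 h2
    rw [show t + δ / 2 - t = δ / 2 by ring, abs_of_pos (by positivity : 0 < δ / 2), abs_lt]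
    constructor <;> linarith [h1.1, h1.2, h2.1, h2.2]
  rw [Real.dist_eq, abs_lt] at h3 ⊢
  rw [abs_lt] at h4
  constructor <;> linarith [h3.1, h3.2, h4.1, h4.2]

variable {E : Type*} [NormedAddCommGroup E] [NormedSpace ℝ E]

/-- A bounded, globally Lipschitz vector field has a solution on the whole line. -/
theorem exists_global_solution [CompleteSpace E] {f : E → E} {K : NNReal}
    (hf : LipschitzWith K f) {L : ℝ} (hL : ∀ y, ‖f y‖ ≤ L) (x₀ : E) :
    ∃ x : ℝ → E, x 0 = x₀ ∧ ∀ t, HasDerivAt x (f (x t)) t := by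
  have hL0 : 0 ≤ L := (norm_nonneg _).trans (hL x₀)
  have key : ∀ n : ℕ, ∃ α : ℝ → E, α 0 = x₀ ∧
      ∀ t ∈ Ioo (-((n : ℝ) + 1)) (n + 1), HasDerivAt α (f (α t)) t := by
    intro n
    have hn : (0 : ℝ) ≤ n := n.cast_nonneg
    -- The bounds on `f` are global, so the radius `L (n + 1)` can be taken as large as the time
    -- interval demands.
    have hP : IsPicardLindelof (fun _ => f) (tmin := -((n : ℝ) + 1)) (tmax := n + 1)
        ⟨0, by constructor <;> linarith⟩ x₀ (⟨L, hL0⟩ * (n + 1)) 0 ⟨L, hL0⟩ K :=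
      { lipschitzOnWith := fun t _ => hf.lipschitzOnWith
        continuousOn := fun _ _ => continuousOn_const
        norm_le := fun t _ y _ => hL y
        mul_max_le := by
          simp only [sub_zero, zero_sub, neg_neg, max_self, NNReal.coe_zero]
          exact le_rfl }
    obtain ⟨α, h0, hα⟩ := hP.exists_eq_forall_mem_Icc_hasDerivWithinAt₀
    exact ⟨α, h0, fun t ht => (hα t (Ioo_subset_Icc_self ht)).hasDerivAt
      (Icc_mem_nhds ht.1 ht.2)⟩
  choose α h0 hα using key
  have agree : ∀ n m : ℕ, n ≤ m → EqOn (α n) (α m) (Ioo (-((n : ℝ) + 1)) (n + 1)) := by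
    intro n m hnm
    have hn : (0 : ℝ) ≤ n := n.cast_nonneg
    have hnm' : (n : ℝ) ≤ m := by exact_mod_cast hnm
    refine ODE_solution_unique_of_mem_Ioo (v := fun _ => f) (s := fun _ => univ) (K := K) (t₀ := 0)
      (fun t _ => hf.lipschitzOnWith) (by constructor <;> linarith)
      (fun t ht => ⟨hα n t ht, mem_univ _⟩)
      (fun t ht => ⟨hα m t ⟨by linarith [ht.1], by linarith [ht.2]⟩, mem_univ _⟩)
      (by rw [h0, h0])
  set N : ℝ → ℕ := fun t => ⌈|t|⌉₊
  have hN : ∀ t, |t| < N t + 1 := fun t => (Nat.le_ceil _).trans_lt (lt_add_one _)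
  refine ⟨fun t => α (N t) t, h0 _, fun t => ?_⟩
  have hmem : t ∈ Ioo (-((N t + 1 : ℕ) : ℝ)) ((N t + 1 : ℕ) : ℝ) := by
    have := abs_lt.1 (hN t); push_cast; exact ⟨this.1, this.2⟩
  -- `N` jumps at integers, so near `t` the glued curve is compared with the one solution of index
  -- `N t + 1`, whose interval contains those of all indices occurring there.
  have hev : (fun s => α (N s) s) =ᶠ[𝓝 t] α (N t + 1) := by
    filter_upwards [Ioo_mem_nhds hmem.1 hmem.2] with s hs
    refine agree _ _ ?_ (abs_lt.1 (hN s))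
    exact Nat.ceil_le.2 (abs_le.2 ⟨hs.1.le, hs.2.le⟩)
  have hd := hα (N t + 1) t (by push_cast at hmem ⊢; constructor <;> linarith [hmem.1, hmem.2])
  have heq := hev.eq_of_nhds
  simp only at heq ⊢
  rw [heq]
  exact hd.congr_of_eventuallyEq hev

/-- For a `C¹` vector field, every point is the start of a global curve which solves the equation
while it stays in a given closed ball. -/
theorem exists_solution_while_mem_closedBall [FiniteDimensional ℝ E] {f : E → E}
    (hf : ContDiff ℝ 1 f) (p : E) {ε : ℝ} (hε : 0 < ε) (x₀ : E) :
    ∃ x : ℝ → E, x 0 = x₀ ∧ Continuous x ∧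
      ∀ t, x t ∈ closedBall p ε → HasDerivAt x (f (x t)) t := by
  have : CompleteSpace E := FiniteDimensional.complete ℝ E
  -- Cutting the field off outside the ball makes it bounded and Lipschitz without changing it on
  -- the closed ball.
  let χ : ContDiffBump p := ⟨ε, ε + 1, hε, by linarith⟩
  have hcs : HasCompactSupport fun y => χ y • f y := χ.hasCompactSupport.smul_right
  have hcd : ContDiff ℝ 1 fun y => χ y • f y := χ.contDiff.smul hf
  obtain ⟨K, hK⟩ := ContDiff.lipschitzWith_of_hasCompactSupport hcs hcd one_ne_zero
  obtain ⟨L, hL⟩ := hcs.exists_bound_of_continuous hcd.continuous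
  obtain ⟨x, hx0, hx⟩ := exists_global_solution hK hL x₀
  refine ⟨x, hx0, continuous_iff_continuousAt.2 fun t => (hx t).continuousAt, fun t ht => ?_⟩
  have := hx t
  rwa [χ.one_of_mem_closedBall ht, one_smul] at this

/-! ### Strictly monotone gradients and strict minima -/

/-- A map to the dual whose strict derivative at a point is positive definite is strictly monotone
near that point. -/
theorem exists_ball_strictMono [FiniteDimensional ℝ E] {G : E → E →L[ℝ] ℝ}
    {A : E →L[ℝ] E →L[ℝ] ℝ} {p : E} (hG : HasStrictFDerivAt G A p)
    (hA : ∀ v, v ≠ 0 → 0 < A v v) :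
    ∃ ε > 0, ∀ x ∈ ball p ε, ∀ y ∈ ball p ε, x ≠ y → 0 < (G x - G y) (x - y) := by
  -- Coercivity: `c` is the minimum of the quadratic form on the unit sphere, which is empty only
  -- for a trivial space.
  obtain ⟨c, hc, hcA⟩ : ∃ c > 0, ∀ v, c * ‖v‖ ^ 2 ≤ A v v := by
    have hcont : Continuous fun v => A v v := by fun_prop
    rcases (sphere (0 : E) 1).eq_empty_or_nonempty with h | h
    · refine ⟨1, one_pos, fun v => ?_⟩
      by_cases hv : v = 0
      · simp [hv]
      · have : ‖v‖⁻¹ • v ∈ sphere (0 : E) 1 := by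
          simp [norm_smul, norm_ne_zero_iff.2 hv]
        rw [h] at this; exact this.elim
    · obtain ⟨u, hu, hmin⟩ := (isCompact_sphere (0 : E) 1).exists_isMinOn h hcont.continuousOn
      have hu0 : u ≠ 0 := by
        rintro rfl; simp at hu
      refine ⟨A u u, hA u hu0, fun v => ?_⟩
      by_cases hv : v = 0
      · simp [hv]
      have hn : ‖v‖ ≠ 0 := norm_ne_zero_iff.2 hv
      have h1 : ‖v‖⁻¹ • v ∈ sphere (0 : E) 1 := by simp [norm_smul, hn]
      have h2 : A u u ≤ A (‖v‖⁻¹ • v) (‖v‖⁻¹ • v) := hmin h1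
      simp only [map_smul, _root_.smul_apply, smul_eq_mul] at h2
      have h3 : 0 < ‖v‖ ^ 2 := by positivity
      calc A u u * ‖v‖ ^ 2 ≤ (‖v‖⁻¹ * (‖v‖⁻¹ * A v v)) * ‖v‖ ^ 2 := by gcongr
        _ = A v v := by field_simp
  -- A linearisation error of at most `c / 2` leaves half of the coercivity constant.
  have hev := (hasStrictFDerivAt_iff_isLittleO.1 hG).def (half_pos hc)
  rw [nhds_prod_eq, (nhds_basis_ball.prod_self).eventually_iff] at hev
  obtain ⟨ε, hε, h⟩ := hev
  refine ⟨ε, hε, fun x hx y hy hxy => ?_⟩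
  have h1 := h (x := (x, y)) ⟨hx, hy⟩
  simp only at h1
  have h2 := hcA (x - y)
  have h3 := (G x - G y - A (x - y)).le_opNorm (x - y)
  have hn : 0 < ‖x - y‖ := norm_pos_iff.2 (sub_ne_zero.2 hxy)
  have h4 := mul_le_mul_of_nonneg_right h1 hn.le
  rw [_root_.sub_apply, Real.norm_eq_abs] at h3
  have h5 := (abs_le.1 (h3.trans h4)).1
  nlinarith [mul_pos hc (pow_pos hn 2)]

/-- A differentiable function with strictly monotone gradient on a ball has a strict minimum at a
critical centre of the ball. -/
theorem lt_of_strictMono_fderiv {F : E → ℝ} (hF : Differentiable ℝ F) {p : E} {ε : ℝ}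
    (hmono : ∀ x ∈ ball p ε, ∀ y ∈ ball p ε, x ≠ y → 0 < (fderiv ℝ F x - fderiv ℝ F y) (x - y))
    (hp : fderiv ℝ F p = 0) {x : E} (hx : x ∈ ball p ε) (hxp : x ≠ p) : F p < F x := by
  have hd : ∀ s : ℝ, HasDerivAt (fun s : ℝ => F (p + s • (x - p)))
      (fderiv ℝ F (p + s • (x - p)) (x - p)) s := by
    intro s
    have h1 : HasDerivAt (fun s : ℝ => p + s • (x - p)) (x - p) s := by
      simpa using ((hasDerivAt_id s).smul_const (x - p)).const_add p
    exact (hF _).hasFDerivAt.comp_hasDerivAt s h1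
  -- The mean value point on the segment from `p` to `x` is compared with `p`, where the gradient is
  -- zero.
  obtain ⟨s, hs, hse⟩ := exists_hasDerivAt_eq_slope _ _ (zero_lt_one' ℝ)
    (fun s _ => (hd s).continuousAt.continuousWithinAt) fun s _ => hd s
  have hn : 0 < ‖x - p‖ := norm_pos_iff.2 (sub_ne_zero.2 hxp)
  have hxε : ‖x - p‖ < ε := by rwa [← dist_eq_norm]
  have hmem : p + s • (x - p) ∈ ball p ε := by
    rw [mem_ball, dist_eq_norm, add_sub_cancel_left, norm_smul, Real.norm_of_nonneg hs.1.le]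
    nlinarith [hs.2]
  have hne : p + s • (x - p) ≠ p := by
    rw [Ne, add_eq_left, smul_eq_zero, not_or]
    exact ⟨hs.1.ne', sub_ne_zero.2 hxp⟩
  have := hmono _ hmem p (mem_ball_self (hn.trans hxε)) hne
  rw [hp, sub_zero, add_sub_cancel_left, map_smul, smul_eq_mul, hse] at this
  simp only [one_smul, zero_smul, add_zero, sub_zero, div_one, add_sub_cancel] at this
  have := pos_of_mul_pos_right this hs.1.le
  linarith

/-! ### Compactness: uniform continuity and unique cluster points -/

/-- A bounded solution is uniformly continuous in time, also after composition with a continuous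
function. -/
theorem uniformContinuousOn_comp_solution [FiniteDimensional ℝ E] {f : E → E} (hf : Continuous f)
    {p : E} {ε : ℝ} {x : ℝ → E} (hx : ∀ t, 0 ≤ t → HasDerivWithinAt x (f (x t)) (Ici 0) t)
    (hmem : ∀ t, 0 ≤ t → x t ∈ closedBall p ε) {g : E → ℝ} (hg : Continuous g) :
    UniformContinuousOn (fun t => g (x t)) (Ici 0) := by
  have : ProperSpace E := FiniteDimensional.proper ℝ E
  have hK := isCompact_closedBall p ε
  obtain ⟨C, hC⟩ := hK.exists_bound_of_continuousOn hf.continuousOn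
  have hlip : LipschitzOnWith C.toNNReal x (Ici 0) := by
    refine (convex_Ici 0).lipschitzOnWith_of_nnnorm_hasDerivWithin_le (fun t ht => hx t ht)
      fun t ht => ?_
    rw [← NNReal.coe_le_coe, coe_nnnorm]
    exact (hC _ (hmem t ht)).trans (Real.le_coe_toNNReal C)
  exact (hK.uniformContinuousOn_of_continuous hg.continuousOn).comp hlip.uniformContinuousOn
    fun t ht => hmem t ht

/-- The only cluster point of a convergent map is its limit. -/
theorem _root_.MapClusterPt.eq_of_tendsto {X Y : Type*} [TopologicalSpace X] [T2Space X]
    {l : Filter Y} {u : Y → X} {a b : X} (ha : MapClusterPt a l u) (hb : Tendsto u l (𝓝 b)) :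
    a = b :=
  eq_of_nhds_neBot (ha.neBot.mono (inf_le_inf_left _ hb))

/-- A trajectory in a compact set along which continuous functions `R` and `κ` tend to `0` and
`k` converges, if these limits are attained by at most one point of the set. -/
theorem exists_tendsto_of_subsingleton {X : Type*} [TopologicalSpace X] {K : Set X}
    (hK : IsCompact K) {x : ℝ → X} (hx : ∀ᶠ t in atTop, x t ∈ K) {R κ : X → ℝ}
    (hR : Continuous R) (hκ : Continuous κ) {k : ℝ}
    (hRx : Tendsto (fun t => R (x t)) atTop (𝓝 0))
    (hκx : Tendsto (fun t => κ (x t)) atTop (𝓝 k))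
    (huniq : {z ∈ K | R z = 0 ∧ κ z = k}.Subsingleton) :
    ∃ z ∈ K, R z = 0 ∧ Tendsto x atTop (𝓝 z) := by
  have hcl : ∀ z, MapClusterPt z atTop x → R z = 0 ∧ κ z = k := fun z hz =>
    ⟨(MapClusterPt.continuousAt_comp hR.continuousAt hz).eq_of_tendsto hRx,
      (MapClusterPt.continuousAt_comp hκ.continuousAt hz).eq_of_tendsto hκx⟩
  obtain ⟨z, hzK, hz⟩ := hK.exists_mapClusterPt_of_frequently (f := x) hx.frequently
  exact ⟨z, hzK, (hcl z hz).1, hK.tendsto_nhds_of_unique_mapClusterPt hx fun y hyK hy =>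
    huniq ⟨hyK, hcl y hy⟩ ⟨hzK, hcl z hz⟩⟩

/-! ### Relative phases -/

section phases

variable {ι : Type*} (r : ι)

theorem extendPhase_relPhase (θ : ι → ℝ) (i : ι) :
    extendPhase r (relPhase r θ) i = θ i - θ r := by
  by_cases h : i = r
  · simp [extendPhase, h]
  · simp [extendPhase, relPhase, h]

theorem contDiff_extendPhase [Fintype ι] [DecidableEq ι] {n : WithTop ℕ∞} : ContDiff ℝ n (extendPhase r) := by
  rw [contDiff_pi]
  intro i
  by_cases h : i = r
  · simpa [extendPhase, h] using contDiff_const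
  · simp only [extendPhase, ne_eq, h, not_false_eq_true, dite_true]
    fun_prop

theorem hasDerivWithinAt_extendPhase {φ : ℝ → {i : ι // i ≠ r} → ℝ} {φ' : {i : ι // i ≠ r} → ℝ}
    {s : Set ℝ} {t : ℝ} (h : ∀ i, HasDerivWithinAt (fun τ => φ τ i) (φ' i) s t) (i : ι) :
    HasDerivWithinAt (fun τ => extendPhase r (φ τ) i) (extendPhase r φ' i) s t := by
  by_cases hi : i = r
  · simpa [extendPhase, hi] using hasDerivWithinAt_const t s (0 : ℝ)
  · simpa [extendPhase, hi] using h ⟨i, hi⟩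

end phases

/-! ### Power flow of the network -/

namespace LossyNetwork

variable {ι : Type*} (N : LossyNetwork ι)

theorem B_symm (i j : ι) : N.B i j = N.B j i := by
  by_cases h : N.graph.Adj i j
  · rw [B, B, if_pos h, if_pos h.symm, N.Z_symm]
  · rw [B, B, if_neg h, if_neg fun h' => h h'.symm]

/-- Conjugation turns the admittance factor `e^{-iφ}` into `e^{iφ}`, which no longer depends on the
element and so factors out of the whole nodal power. -/
theorem conj_div_of_homogeneous {z Z : ℂ} {φ : ℝ} (hZ : Z = (‖Z‖ : ℂ) * Complex.exp (φ * Complex.I)) :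
    (starRingEnd ℂ) (z / Z) =
      Complex.exp (φ * Complex.I) * (((‖Z‖⁻¹ : ℝ) : ℂ) * (starRingEnd ℂ) z) := by
  have h : (starRingEnd ℂ) (Complex.exp (φ * Complex.I)) = (Complex.exp (φ * Complex.I))⁻¹ := by
    rw [← Complex.exp_conj, ← Complex.exp_neg]; simp
  rw [map_div₀]
  conv_lhs => rw [hZ]
  rw [map_mul, h, Complex.conj_ofReal]
  push_cast
  have := Complex.exp_ne_zero (φ * Complex.I)
  field_simp

theorem phasor_eq_mk (θ V : ι → ℝ) (i : ι) :
    phasor θ V i = ⟨V i * Real.cos (θ i), V i * Real.sin (θ i)⟩ := by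
  apply Complex.ext
  · rw [phasor, Complex.re_ofReal_mul, Complex.exp_ofReal_mul_I_re]
  · rw [phasor, Complex.im_ofReal_mul, Complex.exp_ofReal_mul_I_im]

theorem phasor_mul_conj_sub (θ V : ι → ℝ) (i j : ι) :
    phasor θ V i * (starRingEnd ℂ) (phasor θ V i - phasor θ V j) =
      ((V i ^ 2 - V i * V j * Real.cos (θ i - θ j) : ℝ) : ℂ)
        - ((V i * V j * Real.sin (θ i - θ j) : ℝ) : ℂ) * Complex.I := by
  rw [phasor_eq_mk, phasor_eq_mk]
  apply Complex.ext
  · simp only [Complex.mul_re, Complex.conj_re, Complex.conj_im, Complex.sub_re, Complex.sub_im,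
      Complex.ofReal_re, Complex.ofReal_im, Complex.I_re, Complex.I_im, Real.cos_sub]
    linear_combination V i ^ 2 * Real.sin_sq_add_cos_sq (θ i)
  · simp only [Complex.mul_im, Complex.conj_re, Complex.conj_im, Complex.sub_re, Complex.sub_im,
      Complex.ofReal_re, Complex.ofReal_im, Complex.I_re, Complex.I_im, Real.sin_sub]
    ring

theorem phasor_mul_conj_self (θ V : ι → ℝ) (i : ι) :
    phasor θ V i * (starRingEnd ℂ) (phasor θ V i) = ((V i ^ 2 : ℝ) : ℂ) := by
  rw [Complex.mul_conj, Complex.normSq_eq_norm_sq, phasor, norm_mul, Complex.norm_exp_ofReal_mul_I,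
    Complex.norm_real, mul_one, Real.norm_eq_abs, sq_abs]

variable [Fintype ι]

/-- The partial derivatives of the total reactive power (halved) in the voltages: `Q_i / V_i`. -/
def voltGrad (θ V : ι → ℝ) (i : ι) : ℝ :=
  (N.Bhat i + ∑ j, N.B i j) * V i - ∑ j, N.B i j * V j * Real.cos (θ i - θ j)

theorem Q_eq_mul_voltGrad (θ V : ι → ℝ) (i : ι) : N.Q θ V i = V i * N.voltGrad θ V i := by
  simp only [Q, voltGrad, mul_sub, Finset.mul_sum]
  congr 1
  · ring
  · exact Finset.sum_congr rfl fun j _ => by ring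

/-- Line flows are antisymmetric, since `B` is symmetric and the sine odd. This fixes the offset of
the integral controller and makes the choice of reference phase immaterial. -/
theorem sum_P (θ V : ι → ℝ) : ∑ i, N.P θ V i = 0 := by
  have h : ∑ i, N.P θ V i = -∑ i, N.P θ V i := by
    calc ∑ i, N.P θ V i = ∑ j, ∑ i, N.B i j * V i * V j * Real.sin (θ i - θ j) :=
          Finset.sum_comm
      _ = -∑ i, N.P θ V i := by
          rw [← Finset.sum_neg_distrib]
          refine Finset.sum_congr rfl fun j _ => ?_
          rw [P, ← Finset.sum_neg_distrib]
          refine Finset.sum_congr rfl fun i _ => ?_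
          rw [N.B_symm i j, ← neg_sub (θ j), Real.sin_neg]
          ring
  linarith

theorem P_congr {θ θ' : ι → ℝ} {c : ℝ} (h : ∀ i, θ' i = θ i - c) (V : ι → ℝ) :
    N.P θ' V = N.P θ V := by
  funext i; simp only [P, h, sub_sub_sub_cancel_right]

theorem Q_congr {θ θ' : ι → ℝ} {c : ℝ} (h : ∀ i, θ' i = θ i - c) (V : ι → ℝ) :
    N.Q θ' V = N.Q θ V := by
  funext i; simp only [Q, h, sub_sub_sub_cancel_right]

theorem contDiff_P {n : WithTop ℕ∞} (i : ι) :
    ContDiff ℝ n fun y : (ι → ℝ) × (ι → ℝ) => N.P y.1 y.2 i := by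
  unfold P; fun_prop

theorem contDiff_Q {n : WithTop ℕ∞} (i : ι) :
    ContDiff ℝ n fun y : (ι → ℝ) × (ι → ℝ) => N.Q y.1 y.2 i := by
  unfold Q; fun_prop

/-- The gradient of `½ 1ᵀ Q` is `(P, Q / V)`, along any differentiable curve. -/
theorem hasDerivWithinAt_half_sum_Q {θ V : ℝ → ι → ℝ} {θ' V' : ι → ℝ} {s : Set ℝ} {t : ℝ}
    (hθ : ∀ i, HasDerivWithinAt (fun τ => θ τ i) (θ' i) s t)
    (hV : ∀ i, HasDerivWithinAt (fun τ => V τ i) (V' i) s t) :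
    HasDerivWithinAt (fun τ => 1 / 2 * ∑ i, N.Q (θ τ) (V τ) i)
      (∑ i, N.P (θ t) (V t) i * θ' i + ∑ i, N.voltGrad (θ t) (V t) i * V' i) s t := by
  have hQ : ∀ i, HasDerivWithinAt (fun τ => N.Q (θ τ) (V τ) i)
      ((N.Bhat i + ∑ j, N.B i j) * (2 * V t i * V' i) -
        ∑ j, ((N.B i j * V' i * V t j + N.B i j * V t i * V' j) * Real.cos (θ t i - θ t j) +
          N.B i j * V t i * V t j * (-Real.sin (θ t i - θ t j) * (θ' i - θ' j)))) s t := by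
    intro i
    refine HasDerivWithinAt.sub ?_ (HasDerivWithinAt.fun_sum fun j _ => ?_)
    · simpa using ((hV i).pow 2).const_mul (N.Bhat i + ∑ j, N.B i j)
    · exact (((hV i).const_mul _).mul (hV j)).mul ((hθ i).sub (hθ j)).cos
  have h := (HasDerivWithinAt.fun_sum fun i (_ : i ∈ Finset.univ) => hQ i).const_mul (1 / 2 : ℝ)
  refine h.congr_deriv (Eq.symm ?_)
  -- Exchanging the indices (cosine even, sine odd) makes the derivatives at the far end of each
  -- line duplicate those at the near end, which absorbs the factor ½.
  have e1 : ∑ i, ∑ j, N.B i j * V t i * V' j * Real.cos (θ t i - θ t j) =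
      ∑ i, ∑ j, N.B i j * V t j * V' i * Real.cos (θ t i - θ t j) := by
    rw [Finset.sum_comm]
    refine Finset.sum_congr rfl fun j _ => Finset.sum_congr rfl fun i _ => ?_
    rw [N.B_symm i j, ← neg_sub (θ t j), Real.cos_neg]
  have e2 : ∑ i, ∑ j, N.B i j * V t i * V t j * Real.sin (θ t i - θ t j) * θ' j =
      -∑ i, ∑ j, N.B i j * V t i * V t j * Real.sin (θ t i - θ t j) * θ' i := by
    rw [Finset.sum_comm, ← Finset.sum_neg_distrib]
    refine Finset.sum_congr rfl fun j _ => ?_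
    rw [← Finset.sum_neg_distrib]
    refine Finset.sum_congr rfl fun i _ => ?_
    rw [N.B_symm i j, ← neg_sub (θ t j), Real.sin_neg]
    ring
  have e3 : ∀ i, ∑ j, ((N.B i j * V' i * V t j + N.B i j * V t i * V' j) *
        Real.cos (θ t i - θ t j) +
          N.B i j * V t i * V t j * (-Real.sin (θ t i - θ t j) * (θ' i - θ' j))) =
      ∑ j, N.B i j * V t j * V' i * Real.cos (θ t i - θ t j)
      + ∑ j, N.B i j * V t i * V' j * Real.cos (θ t i - θ t j)
      - ∑ j, N.B i j * V t i * V t j * Real.sin (θ t i - θ t j) * θ' i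
      + ∑ j, N.B i j * V t i * V t j * Real.sin (θ t i - θ t j) * θ' j := by
    intro i
    rw [← Finset.sum_add_distrib, ← Finset.sum_sub_distrib, ← Finset.sum_add_distrib]
    exact Finset.sum_congr rfl fun j _ => by ring
  have e4 : ∑ i, N.P (θ t) (V t) i * θ' i =
      ∑ i, ∑ j, N.B i j * V t i * V t j * Real.sin (θ t i - θ t j) * θ' i :=
    Finset.sum_congr rfl fun i _ => by rw [P, Finset.sum_mul]
  have e5 : ∑ i, N.voltGrad (θ t) (V t) i * V' i =
      ∑ i, (N.Bhat i + ∑ j, N.B i j) * V t i * V' i -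
      ∑ i, ∑ j, N.B i j * V t j * V' i * Real.cos (θ t i - θ t j) := by
    rw [← Finset.sum_sub_distrib]
    refine Finset.sum_congr rfl fun i _ => ?_
    rw [voltGrad, sub_mul, Finset.sum_mul]
    congr 1
    exact Finset.sum_congr rfl fun j _ => by ring
  have e6 : ∑ i, (N.Bhat i + ∑ j, N.B i j) * (2 * V t i * V' i) =
      2 * ∑ i, (N.Bhat i + ∑ j, N.B i j) * V t i * V' i := by
    rw [Finset.mul_sum]
    exact Finset.sum_congr rfl fun i _ => by ring
  simp only [e3, Finset.sum_sub_distrib, Finset.sum_add_distrib, e1, e2, e4, e5, e6]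
  ring

/-- For homogeneous impedances, `P^ℓ + i Q^ℓ = e^{iφ} (Q - i P)`. -/
theorem complexPower_eq (θ V : ι → ℝ) (i : ι) :
    N.complexPower θ V i =
      Complex.exp (N.φ * Complex.I) * ((N.Q θ V i : ℂ) - (N.P θ V i : ℂ) * Complex.I) := by
  have h1 : ∀ j, phasor θ V i * (starRingEnd ℂ)
      (open Classical in
        if N.graph.Adj i j then (phasor θ V i - phasor θ V j) / N.Z i j else 0) =
      Complex.exp (N.φ * Complex.I) *
        (((N.B i j * V i ^ 2 - N.B i j * V i * V j * Real.cos (θ i - θ j) : ℝ) : ℂ)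
          - ((N.B i j * V i * V j * Real.sin (θ i - θ j) : ℝ) : ℂ) * Complex.I) := by
    intro j
    by_cases h : N.graph.Adj i j
    · rw [if_pos h, conj_div_of_homogeneous (N.Z_homogeneous i j h), B, if_pos h]
      have := phasor_mul_conj_sub θ V i j
      push_cast at this ⊢
      linear_combination Complex.exp (N.φ * Complex.I) * ((‖N.Z i j‖ : ℂ)⁻¹) * this
    · simp [B, h]
  have h2 : phasor θ V i * (starRingEnd ℂ)
      (open Classical in if i ∈ N.shunt then phasor θ V i / N.Zhat i else 0) =
      Complex.exp (N.φ * Complex.I) * ((N.Bhat i * V i ^ 2 : ℝ) : ℂ) := by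
    by_cases h : i ∈ N.shunt
    · rw [if_pos h, conj_div_of_homogeneous (N.Zhat_homogeneous i h), Bhat, if_pos h]
      have := phasor_mul_conj_self θ V i
      push_cast at this ⊢
      linear_combination Complex.exp (N.φ * Complex.I) * ((‖N.Zhat i‖ : ℂ)⁻¹) * this
    · simp [Bhat, h]
  rw [complexPower, current, map_add, mul_add, h2, map_sum, Finset.mul_sum,
    Finset.sum_congr rfl fun j _ => h1 j, ← Finset.mul_sum, ← mul_add, Finset.sum_sub_distrib,
    ← Finset.sum_mul, ← Complex.ofReal_sum, ← Complex.ofReal_sum, Finset.sum_sub_distrib,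
    ← Finset.sum_mul]
  congr 1
  simp only [Q, P]
  push_cast
  ring

theorem Ploss_eq (θ V : ι → ℝ) (i : ι) :
    N.Ploss θ V i = N.P θ V i * Real.sin N.φ + N.Q θ V i * Real.cos N.φ := by
  rw [Ploss, complexPower_eq, Complex.exp_mul_I]
  simp [Complex.cos_ofReal_re, Complex.sin_ofReal_re]
  ring

theorem Qloss_eq (θ V : ι → ℝ) (i : ι) :
    N.Qloss θ V i = -N.P θ V i * Real.cos N.φ + N.Q θ V i * Real.sin N.φ := by
  rw [Qloss, complexPower_eq, Complex.exp_mul_I]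
  simp [Complex.cos_ofReal_re, Complex.sin_ofReal_re]
  ring

/-- The measured combinations invert the rotation by φ; with the next lemma this reduces the closed
loop to the lossless one. -/
theorem Ploss_sin_sub_Qloss_cos (θ V : ι → ℝ) (i : ι) :
    N.Ploss θ V i * Real.sin N.φ - N.Qloss θ V i * Real.cos N.φ = N.P θ V i := by
  rw [Ploss_eq, Qloss_eq]
  linear_combination N.P θ V i * Real.sin_sq_add_cos_sq N.φ

theorem Ploss_cos_add_Qloss_sin (θ V : ι → ℝ) (i : ι) :
    N.Ploss θ V i * Real.cos N.φ + N.Qloss θ V i * Real.sin N.φ = N.Q θ V i := by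
  rw [Ploss_eq, Qloss_eq]
  linear_combination N.Q θ V i * Real.sin_sq_add_cos_sq N.φ

end LossyNetwork

/-! ### Laplacians of communication graphs -/

namespace CommGraph

variable {ι : Type*} (C : CommGraph ι)

theorem weight_nonneg (i j : ι) : 0 ≤ C.weight i j := by
  by_cases h : C.graph.Adj i j
  · exact (C.weight_pos i j h).le
  · exact (C.weight_eq_zero i j h).ge

variable [Fintype ι]

theorem sum_lap (x : ι → ℝ) : ∑ i, C.lap x i = 0 := by
  have h : ∑ i, C.lap x i = -∑ i, C.lap x i := by
    calc ∑ i, C.lap x i = ∑ j, ∑ i, C.weight i j * (x i - x j) := Finset.sum_comm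
      _ = -∑ i, C.lap x i := by
          rw [← Finset.sum_neg_distrib]
          refine Finset.sum_congr rfl fun j _ => ?_
          rw [lap, ← Finset.sum_neg_distrib]
          refine Finset.sum_congr rfl fun i _ => ?_
          rw [C.weight_symm i j]
          ring
  linarith

theorem lap_sub (x y : ι → ℝ) (i : ι) : C.lap (fun j => x j - y j) i = C.lap x i - C.lap y i := by
  simp only [lap, ← Finset.sum_sub_distrib]
  exact Finset.sum_congr rfl fun j _ => by ring

theorem lap_eq_zero_of_const {x : ι → ℝ} (h : ∀ i j, x i = x j) (i : ι) : C.lap x i = 0 :=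
  Finset.sum_eq_zero fun j _ => by rw [h i j, sub_self, mul_zero]

/-- The quadratic form of the Laplacian. -/
theorem two_mul_sum_mul_lap (x : ι → ℝ) :
    2 * ∑ i, x i * C.lap x i = ∑ i, ∑ j, C.weight i j * (x i - x j) ^ 2 := by
  have h1 : ∑ i, x i * C.lap x i = ∑ i, ∑ j, C.weight i j * (x i - x j) * x i :=
    Finset.sum_congr rfl fun i _ => by
      rw [lap, Finset.mul_sum]; exact Finset.sum_congr rfl fun j _ => by ring
  have h2 : ∑ i, x i * C.lap x i = -∑ i, ∑ j, C.weight i j * (x i - x j) * x j := by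
    rw [h1, Finset.sum_comm, ← Finset.sum_neg_distrib]
    refine Finset.sum_congr rfl fun j _ => ?_
    rw [← Finset.sum_neg_distrib]
    refine Finset.sum_congr rfl fun i _ => ?_
    rw [C.weight_symm i j]
    ring
  calc 2 * ∑ i, x i * C.lap x i
      = ∑ i, ∑ j, C.weight i j * (x i - x j) * x i - ∑ i, ∑ j, C.weight i j * (x i - x j) * x j := by
        linarith
    _ = _ := by
        simp only [← Finset.sum_sub_distrib]
        exact Finset.sum_congr rfl fun i _ => Finset.sum_congr rfl fun j _ => by ring

theorem sum_mul_lap_nonneg (x : ι → ℝ) : 0 ≤ ∑ i, x i * C.lap x i := by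
  have : 0 ≤ ∑ i, ∑ j, C.weight i j * (x i - x j) ^ 2 :=
    Finset.sum_nonneg fun i _ => Finset.sum_nonneg fun j _ =>
      mul_nonneg (C.weight_nonneg i j) (sq_nonneg _)
  linarith [C.two_mul_sum_mul_lap x]

/-- Every term `a_ij (x_i - x_j)²` must vanish, so `x` agrees across each edge and then along a walk
between any two nodes. -/
theorem eq_of_sum_mul_lap_eq_zero {x : ι → ℝ} (h : ∑ i, x i * C.lap x i = 0) (i j : ι) :
    x i = x j := by
  have h0 : ∑ i, ∑ j, C.weight i j * (x i - x j) ^ 2 = 0 := by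
    rw [← C.two_mul_sum_mul_lap, h, mul_zero]
  have hnn : ∀ i j, 0 ≤ C.weight i j * (x i - x j) ^ 2 := fun i j =>
    mul_nonneg (C.weight_nonneg i j) (sq_nonneg _)
  rw [Finset.sum_eq_zero_iff_of_nonneg fun i _ => Finset.sum_nonneg fun j _ => hnn i j] at h0
  have hadj : ∀ i j, C.graph.Adj i j → x i = x j := by
    intro i j hij
    have h1 := h0 i (Finset.mem_univ i)
    rw [Finset.sum_eq_zero_iff_of_nonneg fun j _ => hnn i j] at h1
    have h2 := h1 j (Finset.mem_univ j)
    rw [mul_eq_zero, or_iff_right (C.weight_pos i j hij).ne', sq_eq_zero_iff] at h2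
    exact sub_eq_zero.1 h2
  obtain ⟨w⟩ := C.connected.preconnected i j
  induction w with
  | nil => rfl
  | cons hij _ ih => exact (hadj _ _ hij).trans ih

theorem eq_of_lap_eq_zero {x : ι → ℝ} (h : ∀ i, C.lap x i = 0) (i j : ι) : x i = x j :=
  C.eq_of_sum_mul_lap_eq_zero (by simp [h]) i j

end CommGraph

/-! ### Derivatives along lines -/

section lines

variable {E : Type*} [NormedAddCommGroup E] [NormedSpace ℝ E]

theorem hasDerivAt_line (p v : E) (t : ℝ) : HasDerivAt (fun s : ℝ => p + s • v) v t := by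
  simpa using ((hasDerivAt_id t).smul_const v).const_add p

theorem fderiv_apply_eq_of_line {f : E → ℝ} {p v : E} {d : ℝ} (hf : DifferentiableAt ℝ f p)
    (hd : HasDerivAt (fun s : ℝ => f (p + s • v)) d 0) : fderiv ℝ f p v = d := by
  have h0 : p + (0 : ℝ) • v = p := by simp
  have h1 : HasFDerivAt f (fderiv ℝ f p) (p + (0 : ℝ) • v) := h0.symm ▸ hf.hasFDerivAt
  exact (h1.comp_hasDerivAt 0 (hasDerivAt_line p v 0)).unique hd

/-- Turns the Hessian form into a derivative in one variable, so that two Hessians can be compared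
without a second-order chain rule. -/
theorem hasDerivAt_fderiv_line {f : E → ℝ} {p : E} (v : E) (hf : ContDiffAt ℝ 2 f p) :
    HasDerivAt (fun s : ℝ => fderiv ℝ f (p + s • v) v) (fderiv ℝ (fderiv ℝ f) p v v) 0 := by
  have h0 : p + (0 : ℝ) • v = p := by simp
  have hd : DifferentiableAt ℝ (fderiv ℝ f) p :=
    (hf.fderiv_right (m := 1) (by norm_num)).differentiableAt one_ne_zero
  have h1 : HasFDerivAt (fderiv ℝ f) (fderiv ℝ (fderiv ℝ f) p) (p + (0 : ℝ) • v) :=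
    h0.symm ▸ hd.hasFDerivAt
  have h2 : HasDerivAt (fun s : ℝ => fderiv ℝ f (p + s • v)) (fderiv ℝ (fderiv ℝ f) p v) 0 :=
    h1.comp_hasDerivAt 0 (hasDerivAt_line p v 0)
  exact (ContinuousLinearMap.apply ℝ ℝ v).hasFDerivAt.comp_hasDerivAt 0 h2

end lines

/-! ### The potential in logarithmic voltages -/

/-- Componentwise exponential: the voltages with given logarithms. -/
def expVec {ι : Type*} (l : ι → ℝ) (i : ι) : ℝ := Real.exp (l i)

theorem expVec_pos {ι : Type*} (l : ι → ℝ) (i : ι) : 0 < expVec l i := Real.exp_pos _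

theorem expVec_log {ι : Type*} {V : ι → ℝ} (hV : ∀ i, 0 < V i) :
    expVec (fun i => Real.log (V i)) = V :=
  funext fun i => Real.exp_log (hV i)

theorem contDiff_expVec {ι : Type*} [Fintype ι] {n : WithTop ℕ∞} :
    ContDiff ℝ n (expVec (ι := ι)) := by
  unfold expVec; fun_prop

namespace LossyNetwork

variable {ι : Type*} [Fintype ι] (N : LossyNetwork ι) (r : ι)

/-- The active powers as a function of relative phases and logarithms of the voltages. -/
def logP (y : ({i : ι // i ≠ r} → ℝ) × (ι → ℝ)) : ι → ℝ := N.P (extendPhase r y.1) (expVec y.2)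

/-- The reactive powers as a function of relative phases and logarithms of the voltages. -/
def logQ (y : ({i : ι // i ≠ r} → ℝ) × (ι → ℝ)) : ι → ℝ := N.Q (extendPhase r y.1) (expVec y.2)


/-- The part of the shaped energy that depends on relative phases and voltages, tilted so that the
given powers become critical, in logarithmic coordinates. -/
def potential (Pbar Qbar : ι → ℝ) (y : ({i : ι // i ≠ r} → ℝ) × (ι → ℝ)) : ℝ :=
  1 / 2 * ∑ i, N.logQ r y i - ∑ i, Qbar i * y.2 i - ∑ i, Pbar i * extendPhase r y.1 i

variable (Pbar Qbar : ι → ℝ)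

/-- Because `V_i' = V_i l_i'`, the voltage gradient `Q_i / V_i` becomes `Q_i` itself in logarithmic
coordinates. -/
theorem hasDerivWithinAt_potential {y : ℝ → ({i : ι // i ≠ r} → ℝ) × (ι → ℝ)}
    {y' : ({i : ι // i ≠ r} → ℝ) × (ι → ℝ)} {s : Set ℝ} {t : ℝ}
    (h1 : ∀ i, HasDerivWithinAt (fun τ => (y τ).1 i) (y'.1 i) s t)
    (h2 : ∀ i, HasDerivWithinAt (fun τ => (y τ).2 i) (y'.2 i) s t) :
    HasDerivWithinAt (fun τ => N.potential r Pbar Qbar (y τ))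
      (∑ i, (N.logP r (y t) i - Pbar i) * extendPhase r y'.1 i
        + ∑ i, (N.logQ r (y t) i - Qbar i) * y'.2 i) s t := by
  have e1 := hasDerivWithinAt_extendPhase r h1
  have e2 : ∀ i, HasDerivWithinAt (fun τ => expVec (y τ).2 i) (expVec (y t).2 i * y'.2 i) s t :=
    fun i => (h2 i).exp
  have h := ((N.hasDerivWithinAt_half_sum_Q e1 e2).sub (HasDerivWithinAt.fun_sum
    fun i (_ : i ∈ Finset.univ) => (h2 i).const_mul (Qbar i))).sub (HasDerivWithinAt.fun_sum
    fun i (_ : i ∈ Finset.univ) => (e1 i).const_mul (Pbar i))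
  refine h.congr_deriv ?_
  simp only [sub_mul, Finset.sum_sub_distrib, logP, logQ, Q_eq_mul_voltGrad]
  have : ∀ i, N.voltGrad (extendPhase r (y t).1) (expVec (y t).2) i * (expVec (y t).2 i * y'.2 i) =
    expVec (y t).2 i * N.voltGrad (extendPhase r (y t).1) (expVec (y t).2) i * y'.2 i :=
    fun i => by ring
  simp only [this]
  ring

variable [DecidableEq ι]

theorem contDiff_network_coord {n : WithTop ℕ∞} :
    ContDiff ℝ n fun y : ({i : ι // i ≠ r} → ℝ) × (ι → ℝ) => (extendPhase r y.1, expVec y.2) :=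
  ((contDiff_extendPhase r).comp contDiff_fst).prodMk (contDiff_expVec.comp contDiff_snd)

theorem contDiff_logP {n : WithTop ℕ∞} (i : ι) : ContDiff ℝ n fun y => N.logP r y i :=
  (N.contDiff_P i).comp (contDiff_network_coord r)

theorem contDiff_logQ {n : WithTop ℕ∞} (i : ι) : ContDiff ℝ n fun y => N.logQ r y i :=
  (N.contDiff_Q i).comp (contDiff_network_coord r)

theorem contDiff_potential {n : WithTop ℕ∞} : ContDiff ℝ n (N.potential r Pbar Qbar) := by
  have h := fun i => (contDiff_pi.1 (contDiff_extendPhase r (n := n)) i).comp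
    (contDiff_fst (E := {i : ι // i ≠ r} → ℝ) (F := ι → ℝ))
  have h' := fun i => N.contDiff_logQ r (n := n) i
  refine ((contDiff_const.mul (ContDiff.sum fun i _ => h' i)).sub
    (ContDiff.sum fun i _ => ?_)).sub (ContDiff.sum fun i _ => contDiff_const.mul (h i))
  fun_prop

theorem fderiv_potential (y v : ({i : ι // i ≠ r} → ℝ) × (ι → ℝ)) :
    fderiv ℝ (N.potential r Pbar Qbar) y v =
      ∑ i, (N.logP r y i - Pbar i) * extendPhase r v.1 i
        + ∑ i, (N.logQ r y i - Qbar i) * v.2 i := by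
  have h := N.hasDerivWithinAt_potential r Pbar Qbar (y := fun s : ℝ => y + s • v) (y' := v)
    (s := univ) (t := 0)
    (fun i => (hasDerivAt_line (y.1 i) (v.1 i) 0).hasDerivWithinAt)
    (fun i => (hasDerivAt_line (y.2 i) (v.2 i) 0).hasDerivWithinAt)
  rw [hasDerivWithinAt_univ, zero_smul, add_zero] at h
  exact fderiv_apply_eq_of_line
    ((N.contDiff_potential r Pbar Qbar (n := 1)).differentiable one_ne_zero y) h

end LossyNetwork

/-! ### Transfer of the Hessian condition -/

namespace LossyMicrogrid

variable {ι : Type*} [Fintype ι] [DecidableEq ι] (M : LossyMicrogrid ι) (r : ι) (Qbar : ι → ℝ)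

theorem contDiffAt_S {n : WithTop ℕ∞} {q : ({i : ι // i ≠ r} → ℝ) × (ι → ℝ) × (ι → ℝ)}
    (hq : ∀ i, 0 < q.2.2 i) : ContDiffAt ℝ n (M.S r Qbar) q := by
  have hQ : ∀ i, ContDiff ℝ n fun q : ({i : ι // i ≠ r} → ℝ) × (ι → ℝ) × (ι → ℝ) =>
      M.net.Q (extendPhase r q.1) q.2.2 i := fun i =>
    (M.net.contDiff_Q i).comp (((contDiff_extendPhase r).comp contDiff_fst).prodMk
      (contDiff_snd.comp contDiff_snd))
  have hω : ContDiff ℝ n fun q : ({i : ι // i ≠ r} → ℝ) × (ι → ℝ) × (ι → ℝ) =>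
      1 / 2 * ∑ i, (M.kP i)⁻¹ * M.tP i * q.2.1 i ^ 2 := by fun_prop
  refine (hω.add (contDiff_const.mul (ContDiff.sum fun i _ => hQ i))).contDiffAt.sub
    (ContDiffAt.sum fun i _ => contDiffAt_const.mul (ContDiffAt.log ?_ (hq i).ne'))
  fun_prop

/-- Directions without a frequency component suffice, since the potential does not involve `ω`. -/
theorem fderiv_S_apply {q v : ({i : ι // i ≠ r} → ℝ) × (ι → ℝ) × (ι → ℝ)}
    (hq : ∀ i, 0 < q.2.2 i) (hv : v.2.1 = 0) :
    fderiv ℝ (M.S r Qbar) q v =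
      ∑ i, M.net.P (extendPhase r q.1) q.2.2 i * extendPhase r v.1 i
        + ∑ i, (M.net.Q (extendPhase r q.1) q.2.2 i - Qbar i) * ((q.2.2 i)⁻¹ * v.2.2 i) := by
  have c1 : ∀ i, HasDerivWithinAt (fun s : ℝ => (q.1 + s • v.1) i) (v.1 i) univ 0 := fun i =>
    (hasDerivAt_line (q.1 i) (v.1 i) 0).hasDerivWithinAt
  have c2 : ∀ i, HasDerivWithinAt (fun s : ℝ => (q.2.2 + s • v.2.2) i) (v.2.2 i) univ 0 := fun i =>
    (hasDerivAt_line (q.2.2 i) (v.2.2 i) 0).hasDerivWithinAt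
  have h := ((M.net.hasDerivWithinAt_half_sum_Q (hasDerivWithinAt_extendPhase r c1) c2).const_add
    (1 / 2 * ∑ i, (M.kP i)⁻¹ * M.tP i * q.2.1 i ^ 2)).sub (HasDerivWithinAt.fun_sum
    fun i (_ : i ∈ Finset.univ) => ((c2 i).log (by simpa using (hq i).ne')).const_mul (Qbar i))
  rw [hasDerivWithinAt_univ, zero_smul, zero_smul, add_zero, add_zero] at h
  have h3 := h.congr_of_eventuallyEq (f₁ := fun s : ℝ => M.S r Qbar (q + s • v))
    (Eventually.of_forall fun s => by simp [S, U, hv])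
  rw [fderiv_apply_eq_of_line ((M.contDiffAt_S r Qbar hq (n := 1)).differentiableAt one_ne_zero) h3]
  simp only [sub_mul, Finset.sum_sub_distrib, add_sub_assoc, LossyNetwork.Q_eq_mul_voltGrad]
  congr 2
  · refine Finset.sum_congr rfl fun i _ => ?_
    have := (hq i).ne'
    field_simp
  · exact Finset.sum_congr rfl fun i _ => by ring

/-- Positive definiteness of the Hessian of the shaped energy passes to logarithmic voltages, since
the voltage gradient vanishes at the point considered. -/
theorem hessianPosDef_potential {φ0 : {i : ι // i ≠ r} → ℝ} {ω0 V0 : ι → ℝ} (hV0 : ∀ i, 0 < V0 i)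
    (Pbar : ι → ℝ) (hQ : M.net.Q (extendPhase r φ0) V0 = Qbar)
    (h : HessianPosDef (M.S r Qbar) (φ0, ω0, V0)) :
    HessianPosDef (M.net.potential r Pbar Qbar) (φ0, fun i => Real.log (V0 i)) := by
  rintro ⟨δ, μ⟩ hv
  set p : ({i : ι // i ≠ r} → ℝ) × (ι → ℝ) × (ι → ℝ) := (φ0, ω0, V0)
  set x : ({i : ι // i ≠ r} → ℝ) × (ι → ℝ) := (φ0, fun i => Real.log (V0 i))
  set v : ({i : ι // i ≠ r} → ℝ) × (ι → ℝ) := (δ, μ)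
  -- The image of `v` under the derivative of `l ↦ e^l` at `V0`, with zero frequency component.
  set w : ({i : ι // i ≠ r} → ℝ) × (ι → ℝ) × (ι → ℝ) := (δ, 0, fun i => V0 i * μ i)
  have hw : w ≠ 0 := by
    intro hw0
    apply hv
    simp only [w, Prod.mk_eq_zero] at hw0
    rw [Prod.mk_eq_zero]
    refine ⟨hw0.1, funext fun i => ?_⟩
    have := congrFun hw0.2.2 i
    simpa [(hV0 i).ne'] using this
  have hF2 := hasDerivAt_fderiv_line v
    (M.net.contDiff_potential r Pbar Qbar (n := 2)).contDiffAt (p := x)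
  have hS2 := hasDerivAt_fderiv_line w (M.contDiffAt_S r Qbar (q := p) hV0 (n := 2))
  -- the two curves of phases and voltages have the same velocity
  set z : (ι → ℝ) × (ι → ℝ) := (extendPhase r φ0, V0)
  set u : (ι → ℝ) × (ι → ℝ) := (extendPhase r δ, fun i => V0 i * μ i)
  have hext : HasDerivAt (fun s : ℝ => extendPhase r (φ0 + s • δ)) (extendPhase r δ) 0 := by
    rw [hasDerivAt_pi]
    intro i
    rw [← hasDerivWithinAt_univ]
    exact hasDerivWithinAt_extendPhase r
      (fun j => (hasDerivAt_line (φ0 j) (δ j) 0).hasDerivWithinAt) i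
  set a : ℝ → (ι → ℝ) × (ι → ℝ) := fun s =>
    (extendPhase r (φ0 + s • δ), expVec ((fun i => Real.log (V0 i)) + s • μ))
  set b : ℝ → (ι → ℝ) × (ι → ℝ) := fun s =>
    (extendPhase r (φ0 + s • δ), V0 + s • fun i => V0 i * μ i)
  have ha : HasDerivAt a u 0 := by
    refine hext.prodMk ?_
    rw [hasDerivAt_pi]
    intro i
    have h1 := (hasDerivAt_line (Real.log (V0 i)) (μ i) 0).exp
    rwa [zero_smul, add_zero, Real.exp_log (hV0 i)] at h1
  have hb : HasDerivAt b u 0 := hext.prodMk (hasDerivAt_line _ _ _)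
  have ha0 : a 0 = z := by simp [a, z, expVec_log hV0]
  have hb0 : b 0 = z := by simp [b, z]
  have hsame : ∀ {g : (ι → ℝ) × (ι → ℝ) → ℝ}, ContDiff ℝ 1 g →
      HasDerivAt (fun s => g (a s)) (fderiv ℝ g z u) 0 ∧
      HasDerivAt (fun s => g (b s)) (fderiv ℝ g z u) 0 := by
    intro g hg
    have hz := (hg.differentiable one_ne_zero z).hasFDerivAt
    constructor
    · rw [← ha0] at hz ⊢
      exact hz.comp_hasDerivAt 0 ha
    · rw [← hb0] at hz ⊢
      exact hz.comp_hasDerivAt 0 hb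
  have hP := fun i => hsame (M.net.contDiff_P (n := 1) i)
  have hQd := fun i => hsame (M.net.contDiff_Q (n := 1) i)
  set π : ι → ℝ := fun i => fderiv ℝ (fun y : (ι → ℝ) × (ι → ℝ) => M.net.P y.1 y.2 i) z u
  set κ : ι → ℝ := fun i => fderiv ℝ (fun y : (ι → ℝ) × (ι → ℝ) => M.net.Q y.1 y.2 i) z u
  have hFval : HasDerivAt (fun s : ℝ => fderiv ℝ (M.net.potential r Pbar Qbar) (x + s • v) v)
      (∑ i, π i * extendPhase r δ i + ∑ i, κ i * μ i) 0 := by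
    have h := (HasDerivAt.fun_sum fun i (_ : i ∈ Finset.univ) =>
        ((hP i).1.sub_const (Pbar i)).mul_const (extendPhase r δ i)).add
      (HasDerivAt.fun_sum fun i (_ : i ∈ Finset.univ) =>
        ((hQd i).1.sub_const (Qbar i)).mul_const (μ i))
    refine h.congr_of_eventuallyEq (Eventually.of_forall fun s => ?_)
    exact M.net.fderiv_potential r Pbar Qbar _ _
  have hSval : HasDerivAt (fun s : ℝ => fderiv ℝ (M.S r Qbar) (p + s • w) w)
      (∑ i, π i * extendPhase r δ i + ∑ i, κ i * μ i) 0 := by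
    have hVc : ∀ i, HasDerivAt (fun s : ℝ => V0 i + s • (V0 i * μ i)) (V0 i * μ i) 0 := fun i =>
      hasDerivAt_line _ _ _
    have hpos : ∀ᶠ s in 𝓝 (0 : ℝ), ∀ i, 0 < V0 i + s • (V0 i * μ i) := by
      rw [eventually_all]
      intro i
      refine (hVc i).continuousAt.eventually (lt_mem_nhds ?_)
      simpa using hV0 i
    have h2 : ∀ i, HasDerivAt (fun s : ℝ => (M.net.Q (b s).1 (b s).2 i - Qbar i) *
        ((V0 i + s • (V0 i * μ i))⁻¹ * (V0 i * μ i))) (κ i * μ i) 0 := by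
      intro i
      have h3 := ((hVc i).inv (by simpa using (hV0 i).ne')).mul_const (V0 i * μ i)
      refine (((hQd i).2.sub_const (Qbar i)).mul h3).congr_deriv ?_
      -- `Q - Q̄` vanishes at the base point, so the derivative of `1 / V` does not contribute; this
      -- is where criticality in the voltages enters.
      have h4 : M.net.Q (b 0).1 (b 0).2 i - Qbar i = 0 := by rw [hb0, ← hQ, sub_self]
      have hne := (hV0 i).ne'
      rw [h4, zero_mul, add_zero]
      simp only [Pi.inv_apply, zero_smul, add_zero]
      rw [inv_mul_cancel_left₀ hne]
    have h := (HasDerivAt.fun_sum fun i (_ : i ∈ Finset.univ) =>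
        (hP i).2.mul_const (extendPhase r δ i)).add
      (HasDerivAt.fun_sum fun i (_ : i ∈ Finset.univ) => h2 i)
    refine h.congr_of_eventuallyEq ?_
    filter_upwards [hpos] with s hs
    exact M.fderiv_S_apply r Qbar (q := p + s • w) hs rfl
  rw [hF2.unique hFval, hSval.unique hS2]
  exact h w hw

end LossyMicrogrid

/-! ### The closed loop in logarithmic coordinates: energy, dissipation, charge -/

theorem eq_of_hasDerivWithinAt_zero {g : ℝ → ℝ}
    (h : ∀ t, 0 ≤ t → HasDerivWithinAt g 0 (Ici 0) t) {t : ℝ} (ht : 0 ≤ t) : g t = g 0 := by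
  refine constant_of_has_deriv_right_zero
    (fun s hs => (h s hs.1).continuousWithinAt.mono fun u hu => hu.1)
    (fun s hs => (h s hs.1).mono fun u hu => hs.1.trans hu) t ⟨ht, le_rfl⟩

theorem le_of_hasDerivWithinAt_nonpos {g g' : ℝ → ℝ} {T : ℝ} (hT : 0 ≤ T)
    (h : ∀ t ∈ Icc 0 T, HasDerivWithinAt g (g' t) (Ici 0) t) (hg' : ∀ t ∈ Icc 0 T, g' t ≤ 0) :
    g T ≤ g 0 := by
  have hanti : AntitoneOn g (Icc 0 T) := by
    refine antitoneOn_of_deriv_nonpos (convex_Icc 0 T)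
      (fun s hs => (h s hs).continuousWithinAt.mono fun u hu => hu.1) (fun s hs => ?_)
      fun s hs => ?_
    all_goals
      rw [interior_Icc] at hs
      have hd := (h s (Ioo_subset_Icc_self hs)).hasDerivAt (Ici_mem_nhds hs.1)
    · exact hd.differentiableAt.differentiableWithinAt
    · rw [hd.deriv]; exact hg' s (Ioo_subset_Icc_self hs)
  exact hanti ⟨le_rfl, hT⟩ ⟨hT, le_rfl⟩ hT

/-- The closed loop state in relative phases and logarithms of the voltages:
`(φ, ω, ln V, ξ)`. -/
abbrev LogState (ι : Type*) (r : ι) :=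
  ({i : ι // i ≠ r} → ℝ) × (ι → ℝ) × (ι → ℝ) × (ι → ℝ)

namespace LossyMicrogrid

variable {ι : Type*} [Fintype ι] (M : LossyMicrogrid ι) (r : ι)

/-- The frequency component of the closed loop vector field. -/
def freqField (x : LogState ι r) (i : ι) : ℝ :=
  (M.tP i)⁻¹ * (-(x.2.1 i - M.ωstar)
    - M.kP i * (M.net.logP r (x.1, x.2.2.1) i - M.Pstar i) + x.2.2.2 i)

/-- The closed loop vector field in relative phases and logarithms of the voltages. -/
def logField (x : LogState ι r) : LogState ι r :=
  (fun i => x.2.1 i - x.2.1 r,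
   M.freqField r x,
   fun i => -(M.kQ i * M.commQ.lap (fun j => M.kQ j * M.net.logQ r (x.1, x.2.2.1) j) i),
   fun i => -M.commP.lap x.2.2.2 i + (M.kP i)⁻¹ * (M.ωstar - x.2.1 i))

/-- The Lyapunov function of the closed loop. -/
def lyap (Pbar Qbar : ι → ℝ) (x : LogState ι r) : ℝ :=
  1 / 2 * ∑ i, (M.kP i)⁻¹ * M.tP i * (x.2.1 i - M.ωstar) ^ 2
    + M.net.potential r Pbar Qbar (x.1, x.2.2.1) + 1 / 2 * ∑ i, (x.2.2.2 i - M.uPbar i) ^ 2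

/-- The dissipation rate of the Lyapunov function. -/
def dissipation (Qbar : ι → ℝ) (x : LogState ι r) : ℝ :=
  ∑ i, (M.kP i)⁻¹ * (x.2.1 i - M.ωstar) ^ 2
    + ∑ i, (x.2.2.2 i - M.uPbar i) * M.commP.lap (fun j => x.2.2.2 j - M.uPbar j) i
    + ∑ i, M.kQ i * (M.net.logQ r (x.1, x.2.2.1) i - Qbar i) *
        M.commQ.lap (fun j => M.kQ j * (M.net.logQ r (x.1, x.2.2.1) j - Qbar j)) i

/-- The conserved quantity `1ᵀ K_Q⁻¹ ln V`. -/
def charge (x : LogState ι r) : ℝ := ∑ i, (M.kQ i)⁻¹ * x.2.2.1 i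

/-- The equilibrium conditions of the closed loop. -/
structure IsEquilibrium (Pbar : ι → ℝ) (x : LogState ι r) : Prop where
  freq : ∀ i, x.2.1 i = M.ωstar
  ctrl : ∀ i, x.2.2.2 i = M.uPbar i
  active : ∀ i, M.net.logP r (x.1, x.2.2.1) i = Pbar i
  reactive : ∀ i, M.commQ.lap (fun j => M.kQ j * M.net.logQ r (x.1, x.2.2.1) j) i = 0

theorem dissipation_nonneg (Qbar : ι → ℝ) (x : LogState ι r) : 0 ≤ M.dissipation r Qbar x :=
  add_nonneg (add_nonneg (Finset.sum_nonneg fun i _ =>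
      mul_nonneg (inv_pos.2 (M.kP_pos i)).le (sq_nonneg _)) (M.commP.sum_mul_lap_nonneg _))
    (M.commQ.sum_mul_lap_nonneg fun j => M.kQ j * (M.net.logQ r (x.1, x.2.2.1) j - Qbar j))

theorem sum_inv_kP_pos [Nonempty ι] : 0 < ∑ i, (M.kP i)⁻¹ :=
  Finset.sum_pos (fun i _ => inv_pos.2 (M.kP_pos i)) Finset.univ_nonempty

/-- Where the dissipation and the frequency component of the field vanish, all conditions for an
equilibrium are satisfied. -/
theorem isEquilibrium_of_dissipation_eq_zero {Pbar Qbar : ι → ℝ}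
    (hP : ∀ i, Pbar i = M.Pstar i + (M.kP i)⁻¹ * M.uPbar i) (hPsum : ∑ i, Pbar i = 0)
    (hQ : ∀ i, M.commQ.lap (fun j => M.kQ j * Qbar j) i = 0) {x : LogState ι r}
    (hx : M.dissipation r Qbar x = 0) (hf : ∀ i, M.freqField r x i = 0) :
    M.IsEquilibrium r Pbar x := by
  have n1 : ∀ i ∈ Finset.univ, 0 ≤ (M.kP i)⁻¹ * (x.2.1 i - M.ωstar) ^ 2 := fun i _ =>
    mul_nonneg (inv_pos.2 (M.kP_pos i)).le (sq_nonneg _)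
  have n2 := M.commP.sum_mul_lap_nonneg fun j => x.2.2.2 j - M.uPbar j
  have n3 := M.commQ.sum_mul_lap_nonneg fun j => M.kQ j * (M.net.logQ r (x.1, x.2.2.1) j - Qbar j)
  have n1' := Finset.sum_nonneg n1
  unfold dissipation at hx
  have z1 : ∑ i, (M.kP i)⁻¹ * (x.2.1 i - M.ωstar) ^ 2 = 0 := by linarith
  have hω : ∀ i, x.2.1 i = M.ωstar := by
    intro i
    have := (Finset.sum_eq_zero_iff_of_nonneg n1).1 z1 i (Finset.mem_univ i)
    rw [mul_eq_zero, or_iff_right (inv_pos.2 (M.kP_pos i)).ne', sq_eq_zero_iff] at this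
    exact sub_eq_zero.1 this
  have hξ := M.commP.eq_of_sum_mul_lap_eq_zero (by linarith :
    ∑ i, (x.2.2.2 i - M.uPbar i) * M.commP.lap (fun j => x.2.2.2 j - M.uPbar j) i = 0)
  have hq := M.commQ.eq_of_sum_mul_lap_eq_zero (by linarith :
    ∑ i, M.kQ i * (M.net.logQ r (x.1, x.2.2.1) i - Qbar i) *
        M.commQ.lap (fun j => M.kQ j * (M.net.logQ r (x.1, x.2.2.1) j - Qbar j)) i = 0)
  -- With `ω = ω*` and `ω' = 0` the frequency equation reads `K_P (P - P*) = ξ`, while `ξ - ū_P` is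
  -- a constant vector.
  have hPi : ∀ i, M.net.logP r (x.1, x.2.2.1) i =
      Pbar i + (M.kP i)⁻¹ * (x.2.2.2 r - M.uPbar r) := by
    intro i
    have h1 := hf i
    rw [freqField, mul_eq_zero, or_iff_right (inv_pos.2 (M.tP_pos i)).ne', hω i] at h1
    have hk := (M.kP_pos i).ne'
    rw [← hξ i r, hP i]
    field_simp
    linarith
  -- Both `P` and `P̄` sum to zero, so the offset times `∑ 1 / k_P` is zero.
  have hc : x.2.2.2 r - M.uPbar r = 0 := by
    have : Nonempty ι := ⟨r⟩
    have h1 : ∑ i, M.net.logP r (x.1, x.2.2.1) i = 0 := M.net.sum_P _ _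
    rw [Finset.sum_congr rfl fun i _ => hPi i, Finset.sum_add_distrib, hPsum, zero_add,
      ← Finset.sum_mul, mul_eq_zero, or_iff_right M.sum_inv_kP_pos.ne'] at h1
    exact h1
  refine ⟨hω, fun i => ?_, fun i => ?_, fun i => ?_⟩
  · have := hξ i r; linarith
  · rw [hPi i, hc, mul_zero, add_zero]
  · have h1 := M.commQ.lap_eq_zero_of_const hq i
    have h2 := M.commQ.lap_sub (fun j => M.kQ j * M.net.logQ r (x.1, x.2.2.1) j)
      (fun j => M.kQ j * Qbar j) i
    simp only [← mul_sub] at h2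
    rw [hQ i, sub_zero] at h2
    rw [← h2, h1]

/-- The weight `K_Q⁻¹` cancels the outer `K_Q` of the voltage field, leaving `1ᵀ L_Q = 0`. -/
theorem hasDerivWithinAt_charge [DecidableEq ι] {x : ℝ → LogState ι r} {s : Set ℝ} {t : ℝ}
    (hx : HasDerivWithinAt x (M.logField r (x t)) s t) :
    HasDerivWithinAt (fun τ => M.charge r (x τ)) 0 s t := by
  have hl := fun i => hasDerivWithinAt_pi.1
    ((hasFDerivAt_fst.comp_hasDerivWithinAt t (hasFDerivAt_snd.comp_hasDerivWithinAt t
      (hasFDerivAt_snd.comp_hasDerivWithinAt t hx)))) i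
  refine (HasDerivWithinAt.fun_sum fun i (_ : i ∈ Finset.univ) =>
    (hl i).const_mul (M.kQ i)⁻¹).congr_deriv ?_
  rw [← neg_eq_zero, ← M.commQ.sum_lap fun j => M.kQ j * M.net.logQ r ((x t).1, (x t).2.2.1) j,
    ← Finset.sum_neg_distrib]
  refine Finset.sum_congr rfl fun i _ => ?_
  have := (M.kQ_pos i).ne'
  simp only [logField, ContinuousLinearMap.coe_snd', ContinuousLinearMap.coe_fst']
  field_simp

/-- Two exchange terms cancel: `(P - P̄)(ω - ω*)` between kinetic energy and potential, and `K_P⁻¹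
(ω - ω*)(ξ - ū_P)` between kinetic energy and controller. -/
theorem hasDerivWithinAt_lyap [DecidableEq ι] {Pbar Qbar : ι → ℝ}
    (hP : ∀ i, Pbar i = M.Pstar i + (M.kP i)⁻¹ * M.uPbar i) (hPsum : ∑ i, Pbar i = 0)
    (hQ : ∀ i, M.commQ.lap (fun j => M.kQ j * Qbar j) i = 0)
    {x : ℝ → LogState ι r} {s : Set ℝ} {t : ℝ}
    (hx : HasDerivWithinAt x (M.logField r (x t)) s t) :
    HasDerivWithinAt (fun τ => M.lyap r Pbar Qbar (x τ)) (-M.dissipation r Qbar (x t)) s t := by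
  have hd1 := hasFDerivAt_fst.comp_hasDerivWithinAt t hx
  have hd2 := hasFDerivAt_snd.comp_hasDerivWithinAt t hx
  have hd22 := hasFDerivAt_snd.comp_hasDerivWithinAt t hd2
  have hφ : ∀ i, HasDerivWithinAt (fun τ => (x τ).1 i) ((M.logField r (x t)).1 i) s t := fun i =>
    hasDerivWithinAt_pi.1 hd1 i
  have hω : ∀ i, HasDerivWithinAt (fun τ => (x τ).2.1 i) (M.freqField r (x t) i) s t := fun i =>
    hasDerivWithinAt_pi.1 (hasFDerivAt_fst.comp_hasDerivWithinAt t hd2) i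
  have hl : ∀ i, HasDerivWithinAt (fun τ => (x τ).2.2.1 i) ((M.logField r (x t)).2.2.1 i) s t :=
    fun i => hasDerivWithinAt_pi.1 (hasFDerivAt_fst.comp_hasDerivWithinAt t hd22) i
  have hξ : ∀ i, HasDerivWithinAt (fun τ => (x τ).2.2.2 i) ((M.logField r (x t)).2.2.2 i) s t :=
    fun i => hasDerivWithinAt_pi.1 (hasFDerivAt_snd.comp_hasDerivWithinAt t hd22) i
  have h1 := (HasDerivWithinAt.fun_sum fun i (_ : i ∈ Finset.univ) =>
    (((hω i).sub_const M.ωstar).pow 2).const_mul ((M.kP i)⁻¹ * M.tP i)).const_mul (1 / 2)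
  have h2 := M.net.hasDerivWithinAt_potential r Pbar Qbar
    (y := fun τ => ((x τ).1, (x τ).2.2.1))
    (y' := ((M.logField r (x t)).1, (M.logField r (x t)).2.2.1)) hφ hl
  have h3 := (HasDerivWithinAt.fun_sum fun i (_ : i ∈ Finset.univ) =>
    (((hξ i).sub_const (M.uPbar i)).pow 2)).const_mul (1 / 2)
  refine ((h1.add h2).add h3).congr_deriv ?_
  generalize hX : x t = X
  have e1 : 1 / 2 * ∑ i, (M.kP i)⁻¹ * M.tP i *
      (((2 : ℕ) : ℝ) * (X.2.1 i - M.ωstar) ^ (2 - 1) * M.freqField r X i) =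
      -∑ i, (M.kP i)⁻¹ * (X.2.1 i - M.ωstar) ^ 2
      - ∑ i, (M.net.logP r (X.1, X.2.2.1) i - Pbar i) * (X.2.1 i - M.ωstar)
      + ∑ i, (M.kP i)⁻¹ * (X.2.1 i - M.ωstar) * (X.2.2.2 i - M.uPbar i) := by
    rw [← Finset.sum_neg_distrib, ← Finset.sum_sub_distrib, ← Finset.sum_add_distrib,
      Finset.mul_sum]
    refine Finset.sum_congr rfl fun i _ => ?_
    have hk := (M.kP_pos i).ne'
    have ht := (M.tP_pos i).ne'
    rw [freqField, hP i]
    field_simp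
    push_cast
    ring
  have hext : ∀ i, extendPhase r (M.logField r X).1 i = X.2.1 i - X.2.1 r := fun i =>
    extendPhase_relPhase r X.2.1 i
  -- Relative phases move with `ω_i - ω_r`; since `P - P̄` sums to zero, `ω_r` may be replaced by
  -- `ω*`.
  have e2 : ∑ i, (M.net.logP r (X.1, X.2.2.1) i - Pbar i) * extendPhase r (M.logField r X).1 i =
      ∑ i, (M.net.logP r (X.1, X.2.2.1) i - Pbar i) * (X.2.1 i - M.ωstar) := by
    have hsum : ∑ i, (M.net.logP r (X.1, X.2.2.1) i - Pbar i) = 0 := by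
      rw [Finset.sum_sub_distrib, hPsum, sub_zero]
      exact M.net.sum_P _ _
    rw [← sub_eq_zero, ← Finset.sum_sub_distrib]
    rw [← zero_mul (M.ωstar - X.2.1 r), ← hsum, Finset.sum_mul]
    refine Finset.sum_congr rfl fun i _ => ?_
    rw [hext]; ring
  have e3 : ∑ i, (M.net.logQ r (X.1, X.2.2.1) i - Qbar i) * (M.logField r X).2.2.1 i =
      -∑ i, M.kQ i * (M.net.logQ r (X.1, X.2.2.1) i - Qbar i) *
        M.commQ.lap (fun j => M.kQ j * (M.net.logQ r (X.1, X.2.2.1) j - Qbar j)) i := by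
    rw [← Finset.sum_neg_distrib]
    refine Finset.sum_congr rfl fun i _ => ?_
    have h2 := M.commQ.lap_sub (fun j => M.kQ j * M.net.logQ r (X.1, X.2.2.1) j)
      (fun j => M.kQ j * Qbar j) i
    simp only [← mul_sub] at h2
    rw [h2, hQ i, sub_zero]
    simp only [logField]
    ring
  have e4 : 1 / 2 * ∑ i, (((2 : ℕ) : ℝ) * (X.2.2.2 i - M.uPbar i) ^ (2 - 1) *
      (M.logField r X).2.2.2 i) =
      -∑ i, (X.2.2.2 i - M.uPbar i) * M.commP.lap (fun j => X.2.2.2 j - M.uPbar j) i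
      - ∑ i, (M.kP i)⁻¹ * (X.2.1 i - M.ωstar) * (X.2.2.2 i - M.uPbar i) := by
    rw [← Finset.sum_neg_distrib, ← Finset.sum_sub_distrib, Finset.mul_sum]
    refine Finset.sum_congr rfl fun i _ => ?_
    rw [M.commP.lap_sub, M.commP.lap_eq_zero_of_const (x := M.uPbar) fun _ _ => rfl]
    simp only [logField]
    push_cast
    ring
  have h5 := congrArg₂ (· + ·) (congrArg₂ (· + ·) e1 (congrArg₂ (· + ·) e2 e3)) e4
  refine h5.trans ?_
  simp only [dissipation]
  ring

theorem continuous_charge : Continuous (M.charge r) := by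
  unfold charge; fun_prop

variable [DecidableEq ι]

theorem contDiff_logP_comp {n : WithTop ℕ∞} (i : ι) :
    ContDiff ℝ n fun x : LogState ι r => M.net.logP r (x.1, x.2.2.1) i :=
  (M.net.contDiff_logP r i).comp (f := fun x : LogState ι r => (x.1, x.2.2.1)) (by fun_prop)

theorem contDiff_logQ_comp {n : WithTop ℕ∞} (i : ι) :
    ContDiff ℝ n fun x : LogState ι r => M.net.logQ r (x.1, x.2.2.1) i :=
  (M.net.contDiff_logQ r i).comp (f := fun x : LogState ι r => (x.1, x.2.2.1)) (by fun_prop)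

theorem contDiff_freqField {n : WithTop ℕ∞} (i : ι) :
    ContDiff ℝ n fun x : LogState ι r => M.freqField r x i := by
  have := M.contDiff_logP_comp r (n := n) i
  unfold freqField
  fun_prop

theorem contDiff_logField {n : WithTop ℕ∞} : ContDiff ℝ n (M.logField r) := by
  have hf := M.contDiff_freqField r (n := n)
  have hQ := M.contDiff_logQ_comp r (n := n)
  refine ContDiff.prodMk ?_ (ContDiff.prodMk (contDiff_pi.2 hf) (ContDiff.prodMk ?_ ?_))
  · fun_prop
  all_goals
    unfold CommGraph.lap
    fun_prop

theorem continuous_lyap (Pbar Qbar : ι → ℝ) : Continuous (M.lyap r Pbar Qbar) := by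
  have h := (M.net.contDiff_potential r Pbar Qbar (n := 0)).continuous.comp
    (f := fun x : LogState ι r => (x.1, x.2.2.1)) (by fun_prop)
  unfold lyap
  refine (Continuous.add ?_ h).add ?_ <;> fun_prop

theorem continuous_dissipation (Qbar : ι → ℝ) : Continuous (M.dissipation r Qbar) := by
  have hQ := fun i => (M.contDiff_logQ_comp r (n := 0) i).continuous
  unfold dissipation
  simp only [CommGraph.lap]
  fun_prop

end LossyMicrogrid

/-! ### Trapping and convergence to a single equilibrium -/

namespace LossyMicrogrid

variable {ι : Type*} [Fintype ι] [DecidableEq ι] (M : LossyMicrogrid ι) (r : ι)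

/-- Two equilibria near a nondegenerate minimum of the potential that carry the same charge
coincide. -/
theorem IsEquilibrium.eq_of_charge_eq {M : LossyMicrogrid ι} {r : ι} {Pbar Qbar : ι → ℝ}
    {x y : LogState ι r} (hx : M.IsEquilibrium r Pbar x) (hy : M.IsEquilibrium r Pbar y)
    (hmono : (x.1, x.2.2.1) ≠ (y.1, y.2.2.1) →
      0 < (fderiv ℝ (M.net.potential r Pbar Qbar) (x.1, x.2.2.1) -
        fderiv ℝ (M.net.potential r Pbar Qbar) (y.1, y.2.2.1)) ((x.1, x.2.2.1) - (y.1, y.2.2.1)))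
    (hc : M.charge r x = M.charge r y) : x = y := by
  have hu : (x.1, x.2.2.1) = (y.1, y.2.2.1) := by
    by_contra hne
    have h := hmono hne
    rw [_root_.sub_apply, LossyNetwork.fderiv_potential, LossyNetwork.fderiv_potential] at h
    have hQx := M.commQ.eq_of_lap_eq_zero hx.reactive
    have hQy := M.commQ.eq_of_lap_eq_zero hy.reactive
    simp only [hx.active, hy.active, sub_self, zero_mul, Finset.sum_const_zero, zero_add] at h
    rw [← Finset.sum_sub_distrib] at h
    refine h.ne' ?_
    -- At each equilibrium `k_Q Q` is the same at all nodes, so `K_Q (Q_x - Q_y) = c 1` and the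
    -- pairing with the difference of logarithms is `c` times the charge difference.
    set c := M.kQ r * M.net.logQ r (x.1, x.2.2.1) r - M.kQ r * M.net.logQ r (y.1, y.2.2.1) r
    have : c * (M.charge r x - M.charge r y) = 0 := by rw [hc, sub_self, mul_zero]
    rw [← this, charge, charge, ← Finset.sum_sub_distrib, Finset.mul_sum]
    refine Finset.sum_congr rfl fun i _ => ?_
    have hk := (M.kQ_pos i).ne'
    simp only [c]
    rw [← hQx i r, ← hQy i r]
    simp only [Prod.mk_sub_mk, Pi.sub_apply]
    field_simp
    ring
  rw [Prod.mk.injEq] at hu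
  refine Prod.ext hu.1 (Prod.ext (funext fun i => ?_) (Prod.ext hu.2 (funext fun i => ?_)))
  · rw [hx.freq, hy.freq]
  · rw [hx.ctrl, hy.ctrl]

/-- At a strict minimum of the potential, the Lyapunov function has a strict minimum. -/
theorem lyap_lt {Pbar Qbar : ι → ℝ} {p x : LogState ι r} (hω : ∀ i, p.2.1 i = M.ωstar)
    (hξ : ∀ i, p.2.2.2 i = M.uPbar i)
    (hmin : (x.1, x.2.2.1) ≠ (p.1, p.2.2.1) →
      M.net.potential r Pbar Qbar (p.1, p.2.2.1) < M.net.potential r Pbar Qbar (x.1, x.2.2.1))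
    (hne : x ≠ p) : M.lyap r Pbar Qbar p < M.lyap r Pbar Qbar x := by
  have n1 : ∀ i ∈ Finset.univ, 0 ≤ (M.kP i)⁻¹ * M.tP i * (x.2.1 i - M.ωstar) ^ 2 := fun i _ =>
    mul_nonneg (mul_nonneg (inv_pos.2 (M.kP_pos i)).le (M.tP_pos i).le) (sq_nonneg _)
  have n2 : ∀ i ∈ Finset.univ, 0 ≤ (x.2.2.2 i - M.uPbar i) ^ 2 := fun i _ => sq_nonneg _
  have s1 := Finset.sum_nonneg n1
  have s2 := Finset.sum_nonneg n2
  simp only [lyap, hω, hξ, sub_self, ne_eq, OfNat.ofNat_ne_zero, not_false_eq_true, zero_pow,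
    mul_zero, Finset.sum_const_zero, zero_add, add_zero]
  by_cases hu : (x.1, x.2.2.1) = (p.1, p.2.2.1)
  · rw [hu]
    by_contra hcon
    apply hne
    have z1 := (Finset.sum_eq_zero_iff_of_nonneg n1).1 (by linarith)
    have z2 := (Finset.sum_eq_zero_iff_of_nonneg n2).1 (by linarith)
    rw [Prod.mk.injEq] at hu
    refine Prod.ext hu.1 (Prod.ext (funext fun i => ?_) (Prod.ext hu.2 (funext fun i => ?_)))
    · have h := z1 i (Finset.mem_univ i)
      rw [mul_eq_zero, or_iff_right (mul_pos (inv_pos.2 (M.kP_pos i)) (M.tP_pos i)).ne',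
        sq_eq_zero_iff] at h
      rw [hω i]; linarith
    · have h := z2 i (Finset.mem_univ i)
      rw [sq_eq_zero_iff] at h
      rw [hξ i]; linarith
  · have := hmin hu
    linarith

/-- Local existence for all times and convergence, in relative phases and logarithms of the
voltages. -/
theorem exists_nhds_tendsto_equilibrium {Pbar Qbar : ι → ℝ} {p : LogState ι r}
    (hP : ∀ i, Pbar i = M.Pstar i + (M.kP i)⁻¹ * M.uPbar i)
    (hQ : ∀ i, M.commQ.lap (fun j => M.kQ j * Qbar j) i = 0)
    (hω : ∀ i, p.2.1 i = M.ωstar) (hξ : ∀ i, p.2.2.2 i = M.uPbar i)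
    (hpP : M.net.logP r (p.1, p.2.2.1) = Pbar) (hpQ : M.net.logQ r (p.1, p.2.2.1) = Qbar)
    (hhess : HessianPosDef (M.net.potential r Pbar Qbar) (p.1, p.2.2.1)) :
    ∃ N ∈ 𝓝 p, ∀ x₀ ∈ N,
      (∃ x : ℝ → LogState ι r, Continuous x ∧ x 0 = x₀ ∧
        ∀ t, 0 ≤ t → HasDerivWithinAt x (M.logField r (x t)) (Ici 0) t) ∧
      ∀ x : ℝ → LogState ι r, x 0 = x₀ →
        (∀ t, 0 ≤ t → HasDerivWithinAt x (M.logField r (x t)) (Ici 0) t) →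
        ∃ z, M.IsEquilibrium r Pbar z ∧ Tendsto x atTop (𝓝 z) := by
  have hPsum : ∑ i, Pbar i = 0 := by rw [← hpP]; exact M.net.sum_P _ _
  have hFd := M.net.contDiff_potential r Pbar Qbar (n := 2)
  have hstrict : HasStrictFDerivAt (fderiv ℝ (M.net.potential r Pbar Qbar))
      (fderiv ℝ (fderiv ℝ (M.net.potential r Pbar Qbar)) (p.1, p.2.2.1)) (p.1, p.2.2.1) :=
    (hFd.fderiv_right (m := 1) (by norm_num)).contDiffAt.hasStrictFDerivAt one_ne_zero
  obtain ⟨ρ, hρ, hmono⟩ := exists_ball_strictMono hstrict hhess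
  have hcrit : fderiv ℝ (M.net.potential r Pbar Qbar) (p.1, p.2.2.1) = 0 := by
    refine ContinuousLinearMap.ext fun v => ?_
    rw [LossyNetwork.fderiv_potential, hpP, hpQ]
    simp
  have hproj : ∀ {x : LogState ι r}, x ∈ closedBall p (ρ / 2) →
      (x.1, x.2.2.1) ∈ ball (p.1, p.2.2.1) ρ := by
    intro x hx
    have hx' : dist x p < ρ := lt_of_le_of_lt hx (by linarith)
    simp only [Prod.dist_eq, max_lt_iff] at hx'
    rw [mem_ball, Prod.dist_eq, max_lt_iff]
    exact ⟨hx'.1, hx'.2.2.1⟩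
  have hmin : ∀ x ∈ closedBall p (ρ / 2), x ≠ p → M.lyap r Pbar Qbar p < M.lyap r Pbar Qbar x :=
    fun x hx hne => M.lyap_lt r hω hξ (fun hu => lt_of_strictMono_fderiv
      (hFd.differentiable two_ne_zero) hmono hcrit (hproj hx) hu) hne
  have hlyap := M.continuous_lyap r Pbar Qbar
  obtain ⟨m, hm, hms⟩ : ∃ m, M.lyap r Pbar Qbar p < m ∧
      ∀ y ∈ sphere p (ρ / 2), m ≤ M.lyap r Pbar Qbar y := by
    rcases (sphere p (ρ / 2)).eq_empty_or_nonempty with h | h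
    · exact ⟨_, lt_add_one _, by simp [h]⟩
    · obtain ⟨u, hu, humin⟩ := (isCompact_sphere p (ρ / 2)).exists_isMinOn h hlyap.continuousOn
      refine ⟨_, hmin u (sphere_subset_closedBall hu) ?_, fun y hy => humin hy⟩
      rintro rfl
      rw [mem_sphere, dist_self] at hu
      linarith
  have hstay : ∀ x : ℝ → LogState ι r, ContinuousOn x (Ici 0) → x 0 ∈ ball p (ρ / 2) →
      M.lyap r Pbar Qbar (x 0) < m →
      (∀ t, 0 ≤ t → x t ∈ closedBall p (ρ / 2) →
        HasDerivWithinAt x (M.logField r (x t)) (Ici 0) t) →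
      ∀ t, 0 ≤ t → x t ∈ ball p (ρ / 2) := fun x hx h0 h0m hd =>
    mem_ball_of_lyapunov hx h0 hms h0m fun T hT hmem =>
      le_of_hasDerivWithinAt_nonpos (g := fun t => M.lyap r Pbar Qbar (x t)) hT
        (fun t ht => M.hasDerivWithinAt_lyap r hP hPsum hQ (hd t ht.1 (hmem t ht)))
        fun t _ => neg_nonpos.2 (M.dissipation_nonneg r Qbar (x t))
  refine ⟨ball p (ρ / 2) ∩ {x | M.lyap r Pbar Qbar x < m},
    inter_mem (ball_mem_nhds _ (by positivity)) (hlyap.continuousAt.eventually (gt_mem_nhds hm)),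
    fun x₀ hx₀ => ⟨?_, fun x hx0 hx => ?_⟩⟩
  · obtain ⟨x, hx0, hxc, hx⟩ := exists_solution_while_mem_closedBall
      (M.contDiff_logField r) p (half_pos hρ) x₀
    subst hx0
    refine ⟨x, hxc, rfl, fun t ht => (hx t (ball_subset_closedBall ?_)).hasDerivWithinAt⟩
    exact hstay x hxc.continuousOn hx₀.1 hx₀.2 (fun s _ h => (hx s h).hasDerivWithinAt) t ht
  · subst hx0
    have hmem : ∀ t, 0 ≤ t → x t ∈ closedBall p (ρ / 2) := fun t ht => ball_subset_closedBall <|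
      hstay x (fun s hs => (hx s hs).continuousWithinAt) hx₀.1 hx₀.2 (fun s hs _ => hx s hs) t ht
    have hK := isCompact_closedBall p (ρ / 2)
    have hevent : ∀ᶠ t in atTop, x t ∈ closedBall p (ρ / 2) :=
      (eventually_ge_atTop 0).mono hmem
    have hUC := fun {g : LogState ι r → ℝ} (hg : Continuous g) =>
      uniformContinuousOn_comp_solution (M.contDiff_logField r (n := 0)).continuous hx hmem hg
    have hW : ∀ t, 0 ≤ t → HasDerivWithinAt (fun t => M.lyap r Pbar Qbar (x t))
        (-M.dissipation r Qbar (x t)) (Ici 0) t :=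
      fun t ht => M.hasDerivWithinAt_lyap r hP hPsum hQ (hx t ht)
    have hdiss : Tendsto (fun t => M.dissipation r Qbar (x t)) atTop (𝓝 0) := by
      obtain ⟨l, hl⟩ : ∃ l, Tendsto (fun t => M.lyap r Pbar Qbar (x t)) atTop (𝓝 l) := by
        -- Truncating time at `0` extends the function to the whole line without changing its
        -- behaviour at infinity.
        have hanti : Antitone fun t => M.lyap r Pbar Qbar (x (max t 0)) := by
          intro a b hab
          have hab' := max_le_max_right 0 hab
          have hg := antitoneOn_of_hasDerivWithinAt_nonpos (convex_Ici 0)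
            (fun t ht => (hW t ht).continuousWithinAt)
            (fun t ht => (hW t (interior_subset ht)).mono interior_subset)
            fun t _ => neg_nonpos.2 (M.dissipation_nonneg r Qbar (x t))
          exact hg (le_max_right a 0) (le_max_right b 0) hab'
        have hbdd : BddBelow (range fun t => M.lyap r Pbar Qbar (x (max t 0))) := by
          refine (hK.bddBelow_image hlyap.continuousOn).mono ?_
          rintro _ ⟨t, rfl⟩
          exact ⟨_, hmem _ (le_max_right t 0), rfl⟩
        refine ⟨_, (tendsto_atTop_ciInf hanti hbdd).congr' ?_⟩
        filter_upwards [eventually_ge_atTop 0] with t ht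
        rw [max_eq_left ht]
      have := (tendsto_deriv_zero_of_tendsto hW hl
        (hUC (g := fun x => -M.dissipation r Qbar x) (M.continuous_dissipation r Qbar).neg)).neg
      simpa using this
    -- Vanishing dissipation forces `ω → ω*`, and Barbalat's lemma applied to `ω` then gives `ω' →
    -- 0`. This is needed because the dissipation alone does not see `P - P̄`.
    have hfreq : ∀ i, Tendsto (fun t => M.freqField r (x t) i) atTop (𝓝 0) := by
      intro i
      have hω2 : Tendsto (fun t => (M.kP i)⁻¹ * ((x t).2.1 i - M.ωstar) ^ 2) atTop (𝓝 0) := by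
        refine squeeze_zero (fun t => mul_nonneg (inv_pos.2 (M.kP_pos i)).le (sq_nonneg _))
          (fun t => ?_) hdiss
        have h1 := Finset.single_le_sum (f := fun j => (M.kP j)⁻¹ * ((x t).2.1 j - M.ωstar) ^ 2)
          (fun j _ => mul_nonneg (inv_pos.2 (M.kP_pos j)).le (sq_nonneg _)) (Finset.mem_univ i)
        have h2 := M.commP.sum_mul_lap_nonneg fun j => (x t).2.2.2 j - M.uPbar j
        have h3 := M.commQ.sum_mul_lap_nonneg fun j =>
          M.kQ j * (M.net.logQ r ((x t).1, (x t).2.2.1) j - Qbar j)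
        unfold dissipation
        linarith
      have hωi : Tendsto (fun t => (x t).2.1 i) atTop (𝓝 M.ωstar) := by
        have h1 : Tendsto (fun t => ((x t).2.1 i - M.ωstar) ^ 2) atTop (𝓝 0) := by
          have := hω2.const_mul (M.kP i)
          simpa only [mul_inv_cancel_left₀ (M.kP_pos i).ne', mul_zero] using this
        have h2 := (Real.continuous_sqrt.tendsto 0).comp h1
        simp only [Function.comp_def, Real.sqrt_sq_eq_abs, Real.sqrt_zero] at h2
        have h3 := ((tendsto_zero_iff_abs_tendsto_zero _).2 h2).add_const M.ωstar
        simpa using h3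
      refine tendsto_deriv_zero_of_tendsto (g := fun t => (x t).2.1 i) (fun t ht => ?_) hωi
        (hUC (g := fun x => M.freqField r x i) (M.contDiff_freqField r (n := 0) i).continuous)
      exact hasDerivWithinAt_pi.1 (hasFDerivAt_fst.comp_hasDerivWithinAt t
        (hasFDerivAt_snd.comp_hasDerivWithinAt t (hx t ht))) i
    -- A single continuous function all of whose zeros are equilibria.
    set R : LogState ι r → ℝ := fun x => M.dissipation r Qbar x + ∑ i, |M.freqField r x i|
    have hRc : Continuous R := (M.continuous_dissipation r Qbar).add
      (continuous_finsetSum _ fun i _ => (M.contDiff_freqField r (n := 0) i).continuous.abs)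
    have hRx : Tendsto (fun t => R (x t)) atTop (𝓝 0) := by
      have := hdiss.add (tendsto_finsetSum Finset.univ fun i _ => (hfreq i).abs)
      simpa using this
    have hReq : ∀ {y}, R y = 0 → M.IsEquilibrium r Pbar y := by
      intro y hy
      have h1 := M.dissipation_nonneg r Qbar y
      have h2 : ∀ i ∈ Finset.univ, 0 ≤ |M.freqField r y i| := fun i _ => abs_nonneg _
      have h3 := Finset.sum_nonneg h2
      refine M.isEquilibrium_of_dissipation_eq_zero r hP hPsum hQ (by simp only [R] at hy; linarith)
        fun i => abs_eq_zero.1 ?_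
      exact (Finset.sum_eq_zero_iff_of_nonneg h2).1 (by simp only [R] at hy; linarith) i
        (Finset.mem_univ i)
    have hcharge : Tendsto (fun t => M.charge r (x t)) atTop (𝓝 (M.charge r (x 0))) := by
      refine tendsto_const_nhds.congr' ?_
      filter_upwards [eventually_ge_atTop 0] with t ht
      exact (eq_of_hasDerivWithinAt_zero
        (fun s hs => M.hasDerivWithinAt_charge r (hx s hs)) ht).symm
    obtain ⟨z, -, hz, hlim⟩ := exists_tendsto_of_subsingleton hK hevent hRc
      (M.continuous_charge r) hRx hcharge fun a ha b hb =>
        (hReq ha.2.1).eq_of_charge_eq (hReq hb.2.1)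
          (hmono _ (hproj ha.1) _ (hproj hb.1)) (ha.2.2.trans hb.2.2.symm)
    exact ⟨z, hReq hz, hlim⟩

end LossyMicrogrid

/-! ### Return to the original coordinates -/

section coordinates

variable {ι : Type*} (r : ι)

/-- Relative phases and logarithms of the voltages of a closed loop state. -/
def toLogState (y : (ι → ℝ) × (ι → ℝ) × (ι → ℝ) × (ι → ℝ)) : LogState ι r :=
  (relPhase r y.1, y.2.1, fun i => Real.log (y.2.2.1 i), y.2.2.2)

theorem LossyNetwork.logP_relPhase [Fintype ι] (N : LossyNetwork ι) {θ V : ι → ℝ} (hV : ∀ i, 0 < V i) :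
    N.logP r (relPhase r θ, fun i => Real.log (V i)) = N.P θ V := by
  rw [logP, expVec_log hV]
  exact N.P_congr (extendPhase_relPhase r θ) V

theorem LossyNetwork.logQ_relPhase [Fintype ι] (N : LossyNetwork ι) {θ V : ι → ℝ} (hV : ∀ i, 0 < V i) :
    N.logQ r (relPhase r θ, fun i => Real.log (V i)) = N.Q θ V := by
  rw [logQ, expVec_log hV]
  exact N.Q_congr (extendPhase_relPhase r θ) V

theorem continuousAt_toLogState {y : (ι → ℝ) × (ι → ℝ) × (ι → ℝ) × (ι → ℝ)}
    (hy : ∀ i, 0 < y.2.2.1 i) : ContinuousAt (toLogState r) y := by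
  have h : ContinuousAt (fun y : (ι → ℝ) × (ι → ℝ) × (ι → ℝ) × (ι → ℝ) =>
      fun i => Real.log (y.2.2.1 i)) y :=
    continuousAt_pi.2 fun i => ContinuousAt.log (by fun_prop) (hy i).ne'
  refine ContinuousAt.prodMk ?_ (ContinuousAt.prodMk ?_ (h.prodMk ?_))
  · unfold relPhase; fun_prop
  · fun_prop
  · fun_prop

theorem LossyNetwork.phaseDiff_extendPhase_relPhase (N : LossyNetwork ι) (θ : ι → ℝ) :
    N.phaseDiff (extendPhase r (relPhase r θ)) = N.phaseDiff θ := by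
  funext d
  simp only [phaseDiff, extendPhase_relPhase, sub_sub_sub_cancel_right]

end coordinates

namespace LossyMicrogrid

variable {ι : Type*} [Fintype ι] (M : LossyMicrogrid ι)

theorem hasDerivWithinAt_log_V {θ ω V ξ : ℝ → ι → ℝ} (h : M.IsSolution θ ω V ξ) {t : ℝ}
    (ht : 0 ≤ t) (i : ι) :
    HasDerivWithinAt (fun s => Real.log (V s i))
      (-(M.kQ i * M.commQ.lap (fun j => M.kQ j * M.net.Q (θ t) (V t) j) i)) (Ici 0) t := by
  have hV := (h.V_pos t ht i).ne'
  refine ((h.deriv_V t ht i).log hV).congr_deriv ?_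
  simp only [fEARP, LossyNetwork.Ploss_cos_add_Qloss_sin]
  field_simp

theorem sum_log_V_eq {θ ω V ξ : ℝ → ι → ℝ} (h : M.IsSolution θ ω V ξ) {t : ℝ} (ht : 0 ≤ t) :
    ∑ i, (M.kQ i)⁻¹ * Real.log (V t i) = ∑ i, (M.kQ i)⁻¹ * Real.log (V 0 i) := by
  refine eq_of_hasDerivWithinAt_zero (g := fun t => ∑ i, (M.kQ i)⁻¹ * Real.log (V t i))
    (fun s hs => ?_) ht
  refine (HasDerivWithinAt.fun_sum fun i (_ : i ∈ Finset.univ) =>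
    (M.hasDerivWithinAt_log_V h hs i).const_mul (M.kQ i)⁻¹).congr_deriv ?_
  rw [← neg_eq_zero, ← M.commQ.sum_lap fun j => M.kQ j * M.net.Q (θ s) (V s) j,
    ← Finset.sum_neg_distrib]
  refine Finset.sum_congr rfl fun i _ => ?_
  have := (M.kQ_pos i).ne'
  field_simp

variable (r : ι)

theorem hasDerivWithinAt_toLogState [DecidableEq ι] {θ ω V ξ : ℝ → ι → ℝ}
    (h : M.IsSolution θ ω V ξ) {t : ℝ} (ht : 0 ≤ t) :
    HasDerivWithinAt (fun s => toLogState r (θ s, ω s, V s, ξ s))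
      (M.logField r (toLogState r (θ t, ω t, V t, ξ t))) (Ici 0) t := by
  have hV := h.V_pos t ht
  refine HasDerivWithinAt.prodMk (hasDerivWithinAt_pi.2 fun i => ?_)
    (HasDerivWithinAt.prodMk (hasDerivWithinAt_pi.2 fun i => ?_)
      (HasDerivWithinAt.prodMk (hasDerivWithinAt_pi.2 fun i => ?_)
        (hasDerivWithinAt_pi.2 fun i => h.deriv_ξ t ht i)))
  · exact (h.deriv_θ t ht i).sub (h.deriv_θ t ht r)
  · refine (h.deriv_ω t ht i).congr_deriv ?_
    simp only [freqField, toLogState, LossyNetwork.logP_relPhase r M.net hV,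
      LossyNetwork.Ploss_sin_sub_Qloss_cos]
  · refine (M.hasDerivWithinAt_log_V h ht i).congr_deriv ?_
    simp only [toLogState, LossyNetwork.logQ_relPhase r M.net hV]

/-- A solution in relative phases and logarithms of the voltages lifts to a solution of the closed
loop. -/
theorem exists_isSolution_of_logField [DecidableEq ι] {x : ℝ → LogState ι r} (hxc : Continuous x)
    (hx : ∀ t, 0 ≤ t → HasDerivWithinAt x (M.logField r (x t)) (Ici 0) t)
    {θi ωi Vi ξi : ι → ℝ} (hVi : ∀ i, 0 < Vi i) (h0 : x 0 = toLogState r (θi, ωi, Vi, ξi)) :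
    ∃ θ ω V ξ : ℝ → ι → ℝ, M.IsSolution θ ω V ξ ∧ θ 0 = θi ∧ ω 0 = ωi ∧ V 0 = Vi ∧ ξ 0 = ξi := by
  have hωc : ∀ i, Continuous fun t => (x t).2.1 i := fun i => by fun_prop
  -- Absolute phases are lost in relative coordinates and are recovered by integrating the
  -- frequencies.
  set θ : ℝ → ι → ℝ := fun t i => θi i + ∫ s in (0 : ℝ)..t, (x s).2.1 i
  have hθ : ∀ t i, HasDerivAt (fun s => θ s i) ((x t).2.1 i) t := fun t i =>
    ((hωc i).integral_hasStrictDerivAt 0 t).hasDerivAt.const_add _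
  have hθ0 : θ 0 = θi := by funext i; simp [θ]
  have hd2 := fun t ht => hasFDerivAt_snd.comp_hasDerivWithinAt t (hx t ht)
  have hd22 := fun t ht => hasFDerivAt_snd.comp_hasDerivWithinAt t (hd2 t ht)
  have hrel : ∀ t, 0 ≤ t → (x t).1 = relPhase r (θ t) := by
    intro t ht
    funext i
    have hconst := eq_of_hasDerivWithinAt_zero (g := fun t => (x t).1 i - (θ t i - θ t r))
      (fun s hs => ((hasDerivWithinAt_pi.1 (hasFDerivAt_fst.comp_hasDerivWithinAt s (hx s hs)) i).sub
        ((hθ s i).sub (hθ s r)).hasDerivWithinAt).congr_deriv (sub_self _)) ht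
    have h1 : (x 0).1 i = θi i - θi r := by rw [h0]; rfl
    simp only [h1, hθ0] at hconst
    show (x t).1 i = θ t i - θ t r
    linarith
  have hP : ∀ t, 0 ≤ t →
      M.net.logP r ((x t).1, (x t).2.2.1) = M.net.P (θ t) (expVec (x t).2.2.1) := by
    intro t ht
    rw [hrel t ht, LossyNetwork.logP]
    exact M.net.P_congr (extendPhase_relPhase r (θ t)) _
  have hQ : ∀ t, 0 ≤ t →
      M.net.logQ r ((x t).1, (x t).2.2.1) = M.net.Q (θ t) (expVec (x t).2.2.1) := by
    intro t ht
    rw [hrel t ht, LossyNetwork.logQ]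
    exact M.net.Q_congr (extendPhase_relPhase r (θ t)) _
  refine ⟨θ, fun t => (x t).2.1, fun t => expVec (x t).2.2.1, fun t => (x t).2.2.2,
    ⟨fun t _ => expVec_pos _, fun t _ i => (hθ t i).hasDerivWithinAt, fun t ht i => ?_,
      fun t ht i => ?_, fun t ht i => ?_⟩, hθ0, by simp only [h0, toLogState], ?_,
      by simp only [h0, toLogState]⟩
  · have h1 : HasDerivWithinAt (fun s => (x s).2.1 i) (M.freqField r (x t) i) (Ici 0) t :=
      hasDerivWithinAt_pi.1 (hasFDerivAt_fst.comp_hasDerivWithinAt t (hd2 t ht)) i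
    refine h1.congr_deriv ?_
    simp only [freqField, hP t ht, LossyNetwork.Ploss_sin_sub_Qloss_cos]
  · have h1 : HasDerivWithinAt (fun s => (x s).2.2.1 i) ((M.logField r (x t)).2.2.1 i) (Ici 0) t :=
      hasDerivWithinAt_pi.1 (hasFDerivAt_fst.comp_hasDerivWithinAt t (hd22 t ht)) i
    refine h1.exp.congr_deriv ?_
    simp only [logField, fEARP, hQ t ht, LossyNetwork.Ploss_cos_add_Qloss_sin, expVec]
    ring
  · exact hasDerivWithinAt_pi.1 (hasFDerivAt_snd.comp_hasDerivWithinAt t (hd22 t ht)) i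
  · simp only [h0, toLogState]
    exact expVec_log hVi

theorem isEquilibrium_mem_limitSet {Pbar : ι → ℝ} {z : LogState ι r}
    (hz : M.IsEquilibrium r Pbar z) :
    (M.net.phaseDiff (extendPhase r z.1), z.2.1, expVec z.2.2.1, z.2.2.2) ∈ M.limitSet Pbar :=
  ⟨extendPhase r z.1, z.2.1, expVec z.2.2.1, z.2.2.2, rfl, expVec_pos _, funext hz.freq,
    funext hz.ctrl, funext hz.active, hz.reactive⟩

/-- Proportional sharing of the powers in the lossy network at an equilibrium. -/
theorem IsEquilibrium.sharing {M : LossyMicrogrid ι} {r : ι} {Pbar : ι → ℝ} {z : LogState ι r}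
    (hz : M.IsEquilibrium r Pbar z)
    (hP : ∀ i, Pbar i = M.Pstar i + (M.kP i)⁻¹ * M.uPbar i)
    (hk : ∀ i j, M.kP i / M.kP j = M.kQ i / M.kQ j)
    (hPs : ∀ i j, M.kP i * M.Pstar i = M.kP j * M.Pstar j) (i j : ι) :
    M.kP i * M.net.Ploss (extendPhase r z.1) (expVec z.2.2.1) i =
        M.kP j * M.net.Ploss (extendPhase r z.1) (expVec z.2.2.1) j ∧
      M.kQ i * M.net.Qloss (extendPhase r z.1) (expVec z.2.2.1) i =
        M.kQ j * M.net.Qloss (extendPhase r z.1) (expVec z.2.2.1) j := by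
  have hkPi := M.kP_pos i
  have hkPj := M.kP_pos j
  have hkQi := M.kQ_pos i
  have hkQj := M.kQ_pos j
  -- Equal ratios make `k_P` and `k_Q` proportional, so either set of gains equalises both lossless
  -- powers, and hence their combinations `P^ℓ` and `Q^ℓ`.
  have hcross : M.kP i * M.kQ j = M.kQ i * M.kP j := by
    have := hk i j
    rwa [div_eq_div_iff hkPj.ne' hkQj.ne'] at this
  have hPeq : M.kP i * M.net.logP r (z.1, z.2.2.1) i = M.kP j * M.net.logP r (z.1, z.2.2.1) j := by
    rw [hz.active, hz.active, hP, hP, mul_add, mul_add, mul_inv_cancel_left₀ hkPi.ne',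
      mul_inv_cancel_left₀ hkPj.ne', hPs i j]
    rfl
  have hQeq : M.kQ i * M.net.logQ r (z.1, z.2.2.1) i = M.kQ j * M.net.logQ r (z.1, z.2.2.1) j :=
    M.commQ.eq_of_lap_eq_zero hz.reactive i j
  have hPeq' : M.kQ i * M.net.logP r (z.1, z.2.2.1) i =
      M.kQ j * M.net.logP r (z.1, z.2.2.1) j := by
    refine mul_left_cancel₀ hkPj.ne' ?_
    linear_combination M.kQ j * hPeq - M.net.logP r (z.1, z.2.2.1) i * hcross
  have hQeq' : M.kP i * M.net.logQ r (z.1, z.2.2.1) i =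
      M.kP j * M.net.logQ r (z.1, z.2.2.1) j := by
    refine mul_left_cancel₀ hkQj.ne' ?_
    linear_combination M.kP j * hQeq + M.net.logQ r (z.1, z.2.2.1) i * hcross
  simp only [LossyNetwork.logP, LossyNetwork.logQ] at hPeq hQeq hPeq' hQeq'
  rw [LossyNetwork.Ploss_eq, LossyNetwork.Ploss_eq, LossyNetwork.Qloss_eq, LossyNetwork.Qloss_eq]
  constructor
  · linear_combination Real.sin M.net.φ * hPeq + Real.cos M.net.φ * hQeq'
  · linear_combination -Real.cos M.net.φ * hPeq' + Real.sin M.net.φ * hQeq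

end LossyMicrogrid

/-! ### Continuity and phase invariance of the lossy powers -/

namespace LossyNetwork

variable {ι : Type*} [Fintype ι] (N : LossyNetwork ι)

theorem continuous_Ploss :
    Continuous fun y : (ι → ℝ) × (ι → ℝ) => N.Ploss y.1 y.2 := by
  have hP := fun i => (N.contDiff_P (n := 0) i).continuous
  have hQ := fun i => (N.contDiff_Q (n := 0) i).continuous
  refine continuous_pi fun i => ?_
  simp only [Ploss_eq]
  fun_prop

theorem continuous_Qloss :
    Continuous fun y : (ι → ℝ) × (ι → ℝ) => N.Qloss y.1 y.2 := by
  have hP := fun i => (N.contDiff_P (n := 0) i).continuous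
  have hQ := fun i => (N.contDiff_Q (n := 0) i).continuous
  refine continuous_pi fun i => ?_
  simp only [Qloss_eq]
  fun_prop

theorem Ploss_congr {θ θ' : ι → ℝ} {c : ℝ} (h : ∀ i, θ' i = θ i - c) (V : ι → ℝ) :
    N.Ploss θ' V = N.Ploss θ V := by
  funext i; rw [Ploss_eq, Ploss_eq, N.P_congr h, N.Q_congr h]

theorem Qloss_congr {θ θ' : ι → ℝ} {c : ℝ} (h : ∀ i, θ' i = θ i - c) (V : ι → ℝ) :
    N.Qloss θ' V = N.Qloss θ V := by
  funext i; rw [Qloss_eq, Qloss_eq, N.P_congr h, N.Q_congr h]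

end LossyNetwork

end Microgrid
end

/-! ### The theorem -/

theorem proposition3 {ι : Type*} [Fintype ι] [DecidableEq ι]
    (M : Microgrid.LossyMicrogrid ι)
    (r : ι) (θ0 Vbar : ι → ℝ)
    (hfeas : M.Feasible θ0 Vbar)
    (hconvex : Microgrid.HessianPosDef (M.S r (M.net.Q θ0 Vbar))
      (Microgrid.relPhase r θ0, (fun _ => M.ωstar), Vbar)) :
    -- local convergence to a point, and sharing of the actual powers
    (∃ U ∈ 𝓝 (θ0, ((fun _ => M.ωstar : ι → ℝ), (Vbar, M.uPbar))),
      ∀ θi ωi Vi ξi : ι → ℝ, (θi, (ωi, (Vi, ξi))) ∈ U →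
        (∃ θ ω V ξ : ℝ → ι → ℝ, M.IsSolution θ ω V ξ ∧
          θ 0 = θi ∧ ω 0 = ωi ∧ V 0 = Vi ∧ ξ 0 = ξi) ∧
        ∀ θ ω V ξ : ℝ → ι → ℝ, M.IsSolution θ ω V ξ →
          θ 0 = θi → ω 0 = ωi → V 0 = Vi → ξ 0 = ξi →
          (∃ x ∈ M.limitSet (M.net.P θ0 Vbar),
            Tendsto (fun t => (M.net.phaseDiff (θ t), ω t, V t, ξ t)) atTop (𝓝 x)) ∧
          ∃ Pl Ql : ι → ℝ,
            Tendsto (fun t => M.net.Ploss (θ t) (V t)) atTop (𝓝 Pl) ∧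
            Tendsto (fun t => M.net.Qloss (θ t) (V t)) atTop (𝓝 Ql) ∧
            ((∀ i j, M.kP i / M.kP j = M.kQ i / M.kQ j) →
              (∀ i j, M.kP i * M.Pstar i = M.kP j * M.Pstar j) →
              ∀ i j, M.kP i * Pl i = M.kP j * Pl j ∧ M.kQ i * Ql i = M.kQ j * Ql j)) ∧
    -- the conserved quantity, along every solution
    (∀ θ ω V ξ : ℝ → ι → ℝ, M.IsSolution θ ω V ξ → ∀ t, 0 ≤ t →
      ∑ i, (M.kQ i)⁻¹ * Real.log (V t i) = ∑ i, (M.kQ i)⁻¹ * Real.log (V 0 i)) := by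
  open Microgrid in
  refine ⟨?_, fun θ ω V ξ h t ht => M.sum_log_V_eq h ht⟩
  have hVbar := hfeas.V_pos
  have hP : ∀ i, M.net.P θ0 Vbar i = M.Pstar i + (M.kP i)⁻¹ * M.uPbar i := fun i => by
    rw [hfeas.active i, LossyMicrogrid.uPbar]; ring
  have hQ : ∀ i, M.commQ.lap (fun j => M.kQ j * M.net.Q θ0 Vbar j) i = 0 := fun i => by
    have h := hfeas.reactive i
    rw [LossyMicrogrid.fEARP, neg_eq_zero, mul_eq_zero, or_iff_right (hVbar i).ne', mul_eq_zero,
      or_iff_right (M.kQ_pos i).ne'] at h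
    exact h
  have hQ0 : M.net.Q (extendPhase r (relPhase r θ0)) Vbar = M.net.Q θ0 Vbar :=
    M.net.Q_congr (extendPhase_relPhase r θ0) Vbar
  obtain ⟨N, hN, hmain⟩ := M.exists_nhds_tendsto_equilibrium r
    (p := toLogState r (θ0, (fun _ => M.ωstar), Vbar, M.uPbar)) hP hQ (fun _ => rfl) (fun _ => rfl)
    (M.net.logP_relPhase r hVbar) (M.net.logQ_relPhase r hVbar)
    (M.hessianPosDef_potential r _ hVbar _ hQ0 hconvex)
  -- Positivity must be imposed separately: `Real.log` is also defined at nonpositive arguments,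
  -- where it does not determine the voltage.
  refine ⟨toLogState r ⁻¹' N ∩ {y | ∀ i, 0 < y.2.2.1 i},
    inter_mem (continuousAt_toLogState r hVbar hN) ?_, ?_⟩
  · refine eventually_all.2 fun i => ?_
    have hc : Continuous fun y : (ι → ℝ) × (ι → ℝ) × (ι → ℝ) × (ι → ℝ) => y.2.2.1 i := by fun_prop
    exact hc.continuousAt.eventually (lt_mem_nhds (hVbar i))
  rintro θi ωi Vi ξi ⟨hmem, hVi⟩
  obtain ⟨⟨x, hxc, hx0, hx⟩, hconv⟩ := hmain _ hmem
  refine ⟨M.exists_isSolution_of_logField r hxc hx hVi hx0, ?_⟩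
  rintro θ ω V ξ hsol rfl rfl rfl rfl
  obtain ⟨z, hz, hlim⟩ := hconv (fun s => toLogState r (θ s, ω s, V s, ξ s)) rfl
    fun t ht => M.hasDerivWithinAt_toLogState r hsol ht
  have hV : ∀ᶠ t in atTop, expVec (fun i => Real.log (V t i)) = V t := by
    filter_upwards [eventually_ge_atTop 0] with t ht
    exact expVec_log (hsol.V_pos t ht)
  have hnet : Tendsto (fun t => (extendPhase r (relPhase r (θ t)), V t)) atTop
      (𝓝 (extendPhase r z.1, expVec z.2.2.1)) := by
    have hc : Continuous fun y : LogState ι r => (extendPhase r y.1, expVec y.2.2.1) :=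
      (LossyNetwork.contDiff_network_coord r (n := 0)).continuous.comp
        (f := fun y : LogState ι r => (y.1, y.2.2.1)) (by fun_prop)
    refine ((hc.tendsto z).comp hlim).congr' ?_
    filter_upwards [hV] with t ht
    simp only [Function.comp_apply, toLogState, ht]
  refine ⟨⟨_, M.isEquilibrium_mem_limitSet r hz, ?_⟩, _, _, ?_, ?_, hz.sharing hP⟩
  · have hpd : Continuous fun θ : ι → ℝ => M.net.phaseDiff θ := by
      unfold LossyNetwork.phaseDiff; fun_prop
    refine Tendsto.prodMk_nhds ?_ (Tendsto.prodMk_nhds ?_ (Tendsto.prodMk_nhds ?_ ?_))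
    · have := (hpd.tendsto _).comp ((continuous_fst.tendsto _).comp hnet)
      refine this.congr fun t => ?_
      exact M.net.phaseDiff_extendPhase_relPhase r (θ t)
    · exact ((continuous_fst.comp continuous_snd).tendsto z).comp hlim
    · exact (continuous_snd.tendsto _).comp hnet
    · exact ((continuous_snd.comp (continuous_snd.comp continuous_snd)).tendsto z).comp hlim
  · refine ((M.net.continuous_Ploss.tendsto _).comp hnet).congr fun t => ?_
    exact M.net.Ploss_congr (extendPhase_relPhase r (θ t)) (V t)
  · refine ((M.net.continuous_Qloss.tendsto _).comp hnet).congr fun t => ?_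
    exact M.net.Qloss_congr (extendPhase_relPhase r (θ t)) (V t)
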